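/- Let $q$ be a prime power, $\mathbf F_q$ the field with $q$ elements, and for $n\ge 1$ let $L_n^*(\mathbf F_q)$ be the poset of subspaces $U$ of $\mathbf F_q^n$ with $0\ne U\ne \mathbf F_q^n$, ordered by inclusion, on which $\mathrm{GL}_n(\mathbf F_q)$ acts by $(g,U)\mapsto gU$. For a finite poset $P$ let $\tilde\chi(P)=\sum_{c}(-1)^{|c|-1}$, the sum over all chains $c\subseteq P$ including the empty one, be its reduced Euler characteristic (so $\tilde\chi(\emptyset)=-1$). For $r\ge 1$ the $r$-th equivariant reduced Euler characteristic is $$\tilde\chi_r(n,q)=\frac1{|\mathrm{GL}_n(\mathbf F_q)|}\sum_{X\in \mathrm{Hom}(\mathbf Z^r,\mathrm{GL}_n(\mathbf F_q))}\tilde\chi\big(L_n^*(\mathbf F_q)^{X(\mathbf Z^r)}\big),$$ where $L_n^*(\mathbf F_q)^{X(\mathbf Z^r)}$ is the subposet of the subspaces invariant under the image of $X$. Let $$F_r(x)=1+\sum_{n\ge1}\tilde\chi_r(n,q)\,x^n .$$ Then, for every prime power $q$, $$F_1(x)=1-x,\qquad F_{r+1}(x)\,F_r(x)=F_r(qx)\quad\text{for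 all } r\ge 1 .$$ Moreover, for every $r\ge1$ there is exactly one power series in $\mathbf Z[q][[x]]$, with $q$ now a variable, whose evaluation at each prime power $q$ is the series $F_r(x)$ at that prime power; and the two identities hold for these series in $\mathbf Z[q][[x]]$. -/

import Mathlib

universe u

/-- The reduced Euler characteristic of a finite poset `P`, that is, of its order complex: the
alternating sum `∑ (-1) ^ dim c` over all chains `c` of `P`, where `dim c = |c| - 1` and the empty
chain (of dimension `-1`) is included. It is `-1` for the empty poset. -/
noncomputable def redEulerChar (P : Type*) [PartialOrder P] [Finite P] : ℤ :=
  ∑ᶠ c : {c : Finset P // IsChain (· ≤ ·) (c : Set P)}, (-1) ^ (c.1.card + 1)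

/-- There are finitely many homomorphisms from `ℤ ^ r` to a finite group. -/
instance finite_hom_zpow (r : ℕ) (G : Type*) [Group G] [Finite G] :
    Finite (Multiplicative (Fin r → ℤ) →* G) := by
  refine Finite.of_injective
    (fun X => fun i : Fin r => X (Multiplicative.ofAdd (Pi.single i (1 : ℤ)))) ?_
  intro X Y h
  have key : AddMonoidHom.toMultiplicativeLeft.symm X =
      AddMonoidHom.toMultiplicativeLeft.symm Y := by
    refine AddMonoidHom.ext fun v => ?_
    have hv : v ∈ AddMonoidHom.eqLocus (AddMonoidHom.toMultiplicativeLeft.symm X)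
        (AddMonoidHom.toMultiplicativeLeft.symm Y) := by
      rw [pi_eq_sum_univ' v]
      refine sum_mem fun i _ => zsmul_mem ?_ _
      have hi := congrArg Additive.ofMul (congrFun h i)
      exact hi
    exact hv
  exact AddMonoidHom.toMultiplicativeLeft.symm.injective key

/-- The `r`th equivariant reduced Euler characteristic of a finite `G`-poset `P`:
the sum over all homomorphisms `X : ℤ ^ r → G` of the reduced Euler characteristic of the subposet
of `P` fixed by the image of `X`, divided by the order of `G`. -/
noncomputable def eqRedEulerChar (r : ℕ) (P G : Type*) [PartialOrder P] [Finite P] [Group G]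
    [Finite G] [MulAction G P] : ℚ :=
  (1 / (Nat.card G : ℚ)) * ∑ᶠ X : Multiplicative (Fin r → ℤ) →* G,
    (redEulerChar (MulAction.fixedPoints X.range P) : ℚ)

/-- The poset of nontrivial proper subspaces of a vector space, ordered by inclusion. -/
abbrev ProperSubspace (K V : Type*) [Field K] [AddCommGroup V] [Module K V] : Type _ :=
  {U : Submodule K V // U ≠ ⊥ ∧ U ≠ ⊤}

/-- The general linear group acts on the nontrivial proper subspaces by taking images. -/
instance glActionProperSubspace (K V : Type*) [Field K] [AddCommGroup V] [Module K V] :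
    MulAction (LinearMap.GeneralLinearGroup K V) (ProperSubspace K V) where
  smul g U := ⟨U.1.map (LinearMap.GeneralLinearGroup.toLinearEquiv g : V →ₗ[K] V),
    fun h => U.2.1 (by simpa using h), fun h => U.2.2 (by simpa using h)⟩
  one_smul U := Subtype.ext (Submodule.map_id U.1)
  mul_smul g h U := Subtype.ext (Submodule.map_comp
    (LinearMap.GeneralLinearGroup.toLinearEquiv h : V →ₗ[K] V)
    (LinearMap.GeneralLinearGroup.toLinearEquiv g : V →ₗ[K] V) U.1)

instance finite_generalLinearGroup (K V : Type*) [Field K] [AddCommGroup V] [Module K V]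
    [Finite V] : Finite (LinearMap.GeneralLinearGroup K V) :=
  Finite.of_injective (fun g : LinearMap.GeneralLinearGroup K V => (g.val : V → V))
    (fun _ _ h => Units.ext (DFunLike.coe_injective h))

/-- `χ̃_r(n, q)`: the `r`th equivariant reduced Euler characteristic of the `GL_n(K)`-poset of
nontrivial proper subspaces of `K ^ n`, for a finite field `K` with `q` elements. -/
noncomputable def chiGL (K : Type u) [Field K] [Finite K] (r n : ℕ) : ℚ :=
  eqRedEulerChar r (ProperSubspace K (Fin n → K)) (LinearMap.GeneralLinearGroup K (Fin n → K))

/-- The `r`th generating function at `q = |K|`, namely `1 + ∑_{n ≥ 1} χ̃_r(n, q) x ^ n`. -/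
noncomputable def genFun (K : Type u) [Field K] [Finite K] (r : ℕ) : PowerSeries ℚ :=
  PowerSeries.mk fun n => if n = 0 then 1 else chiGL K r n

/-- `F ∈ ℤ[q]⟦x⟧` is the `r`th generating function with `q` regarded as a variable: evaluating
`q` at the order of any finite field `K` turns `F` into the `r`th generating function of `K`. -/
def IsGenericGenFun (r : ℕ) (F : PowerSeries (Polynomial ℤ)) : Prop :=
  ∀ (K : Type u) [Field K] [Finite K],
    PowerSeries.map (Polynomial.eval₂RingHom (Int.castRingHom ℚ) (Nat.card K : ℚ)) F = genFun K r

/-! By Philip Hall's theorem, for `n ≥ 1` the reduced Euler characteristic of the subspaces fixed by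
a commuting tuple `x` is the Möbius number `μ(x)` of the lattice of `x`-invariant subspaces. So
`χ̃_r(n, q)` is the sum of `μ(x)` over commuting `r`-tuples in `GL_n`, divided by `|GL_n|`, and the
functional equation says coefficientwise that `q ^ n χ̃_r(n) = ∑ χ̃_{r+1}(a) χ̃_r(b)` over `a + b =
n`.

Two facts give this. First, every vector generates exactly one invariant subspace `C`, and Crapo's
complementation theorem in the modular lattice of invariant subspaces expands `μ(x)` as the sum of
`μ(x|C) μ(x|D)` over invariant complements `D` of `C`. Hence `q ^ n μ(x)` is the sum of `cyc(x|C)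
μ(x|C) μ(x|D)` over invariant decompositions `V = C ⊕ D`, where `cyc` counts cyclic vectors
(`card_mul_tupleSum`).

Second, summing `μ(x, g)` over all `g` commuting with `x` gives `cyc(x) μ(x)`, so the weight `cyc`
amounts to one more commuting automorphism (`tupleSum_succ`). This is a statement on a finite module
`N` over a commutative ring (`tupleSum_unit`). If `N` is cyclic, its automorphisms are scalars and
correspond to generators. If not, both sides vanish: Crapo's theorem at `m N`, for a maximal ideal
`m`, reduces the claim to smaller modules and to vector spaces of dimension at least 2, which is the
case `r = 1` (`tupleSum_unit_eq_zero`).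

Counting decompositions by dimension turns this into the product of series. Since `F_r` has constant
term 1, the recursion can be solved over `ℤ[q]`, and infinitely many prime values of `q` determine
the solution. -/

/-! ### Möbius numbers of finite posets and Crapo's theorem. -/

section Moebius

open Classical in
/-- The reduced Euler characteristic of the subposet `s` of `P`, as a sum over chains in `P`. -/
noncomputable def chainSum {P : Type*} [PartialOrder P] [Finite P] (s : Set P) : ℤ :=
  letI := Fintype.ofFinite P
  ∑ c ∈ Finset.univ.filter fun c : Finset P => (c : Set P) ⊆ s ∧ IsChain (· ≤ ·) (c : Set P),
    (-1) ^ (c.card + 1)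

open Classical in
theorem chainSum_eq {P : Type*} [PartialOrder P] [Fintype P] (s : Set P) :
    chainSum s =
      ∑ c ∈ Finset.univ.filter fun c : Finset P => (c : Set P) ⊆ s ∧ IsChain (· ≤ ·) (c : Set P),
    (-1) ^ (c.card + 1) := by
  unfold chainSum
  congr!

open Classical in
theorem chainSum_image {P Q : Type*} [PartialOrder P] [Finite P] [PartialOrder Q] [Finite Q]
    (e : P ↪o Q) (s : Set P) : chainSum (e '' s) = chainSum s := by
  have := Fintype.ofFinite P
  have := Fintype.ofFinite Q
  rw [chainSum_eq, chainSum_eq]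
  symm
  refine Finset.sum_bij (fun c _ => c.map e.toEmbedding) ?_ ?_ ?_ ?_
  · intro c hc
    simp only [Finset.mem_filter, Finset.mem_univ, true_and] at hc ⊢
    rw [Finset.coe_map]
    refine ⟨Set.image_mono hc.1, ?_⟩
    rintro _ ⟨x, hx, rfl⟩ _ ⟨y, hy, rfl⟩ hxy
    simpa using hc.2 hx hy fun h => hxy (congrArg _ h)
  · intro c _ d _ h
    exact Finset.map_injective _ h
  · intro d hd
    simp only [Finset.mem_filter, Finset.mem_univ, true_and] at hd
    obtain ⟨c, hc⟩ : ∃ c : Finset P, c.map e.toEmbedding = d := by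
      refine ⟨d.preimage e e.injective.injOn, ?_⟩
      ext y
      simp only [Finset.mem_map, Finset.mem_preimage]
      constructor
      · rintro ⟨x, hx, rfl⟩
        exact hx
      · intro hy
        obtain ⟨x, -, rfl⟩ := hd.1 hy
        exact ⟨x, hy, rfl⟩
    refine ⟨c, ?_, hc⟩
    subst hc
    simp only [Finset.mem_filter, Finset.mem_univ, true_and]
    rw [Finset.coe_map] at hd
    refine ⟨(Set.image_subset_image_iff e.injective).1 hd.1, ?_⟩
    intro x hx y hy hxy
    have := hd.2 ⟨x, hx, rfl⟩ ⟨y, hy, rfl⟩ (fun h => hxy (e.injective h))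
    simpa using this
  · intro c _
    simp

open Classical in
theorem redEulerChar_eq_chainSum {P : Type*} [PartialOrder P] [Finite P] :
    redEulerChar P = chainSum (Set.univ : Set P) := by
  have := Fintype.ofFinite P
  rw [chainSum_eq, redEulerChar, finsum_eq_sum_of_fintype]
  simp only [Set.subset_univ, true_and]
  rw [Finset.sum_subtype (p := fun c : Finset P => IsChain (· ≤ ·) (c : Set P))]
  simp

open Classical in
/-- Splitting off the largest element of a nonempty chain. -/
theorem chainSum_rec {P : Type*} [PartialOrder P] [Fintype P] (s : Set P) :
    chainSum s = -1 - ∑ x : P with x ∈ s, chainSum (s ∩ Set.Iio x) := by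
  have key : ∀ x ∈ s, chainSum (s ∩ Set.Iio x) =
      - ∑ c ∈ Finset.univ.filter fun c : Finset P =>
        ((c : Set P) ⊆ s ∧ IsChain (· ≤ ·) (c : Set P)) ∧ IsGreatest (c : Set P) x,
          (-1 : ℤ) ^ (c.card + 1) := by
    intro x hx
    rw [chainSum_eq, ← Finset.sum_neg_distrib]
    have hnot : ∀ c : Finset P, (c : Set P) ⊆ s ∩ Set.Iio x → x ∉ c := fun c hc hxc =>
      lt_irrefl x (hc hxc).2
    refine Finset.sum_bij (fun c _ => insert x c) ?_ ?_ ?_ ?_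
    · intro c hc
      simp only [Finset.mem_filter, Finset.mem_univ, true_and] at hc ⊢
      rw [Finset.coe_insert]
      refine ⟨⟨Set.insert_subset hx (hc.1.trans Set.inter_subset_left), ?_⟩,
        Set.mem_insert _ _, ?_⟩
      · exact hc.2.insert fun y hy _ => Or.inr (hc.1 hy).2.le
      · rintro y (rfl | hy)
        · exact le_rfl
        · exact (hc.1 hy).2.le
    · intro c hc d hd h
      simp only [Finset.mem_filter, Finset.mem_univ, true_and] at hc hd
      rw [← Finset.erase_insert (hnot c hc.1), h, Finset.erase_insert (hnot d hd.1)]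
    · intro d hd
      simp only [Finset.mem_filter, Finset.mem_univ, true_and] at hd
      refine ⟨d.erase x, ?_, Finset.insert_erase hd.2.1⟩
      simp only [Finset.mem_filter, Finset.mem_univ, true_and, Finset.coe_erase]
      refine ⟨fun y hy => ⟨hd.1.1 hy.1, lt_of_le_of_ne (hd.2.2 hy.1) hy.2⟩,
        hd.1.2.mono Set.sdiff_subset⟩
    · intro c hc
      simp only [Finset.mem_filter, Finset.mem_univ, true_and] at hc
      rw [Finset.card_insert_of_notMem (hnot c hc.1)]
      ring
  rw [Finset.sum_congr rfl (fun x hx => key x (Finset.mem_filter.1 hx).2), Finset.sum_neg_distrib,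
    chainSum_eq, sub_neg_eq_add]
  simp only [Finset.sum_filter (p := fun c : Finset P => ((c : Set P) ⊆ s ∧
    IsChain (· ≤ ·) (c : Set P)) ∧ IsGreatest (c : Set P) _)]
  -- After exchanging the sums, each nonempty chain is counted once, at its greatest element; the
  -- empty chain accounts for the `-1`.
  rw [Finset.sum_comm, Finset.sum_filter,
    ← Finset.add_sum_erase Finset.univ _ (Finset.mem_univ (∅ : Finset P))]
  conv_rhs => rw [← Finset.add_sum_erase Finset.univ _ (Finset.mem_univ (∅ : Finset P))]
  have h0 : ∀ x : P, ¬ IsGreatest ((∅ : Finset P) : Set P) x := fun x h => by simpa using h.1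
  simp only [h0, and_false, if_false, Finset.sum_const_zero, zero_add]
  congr 1
  · simp
  refine Finset.sum_congr rfl fun c hc => ?_
  have hne : c.Nonempty := Finset.nonempty_iff_ne_empty.2 (Finset.ne_of_mem_erase hc)
  by_cases h : (c : Set P) ⊆ s ∧ IsChain (· ≤ ·) (c : Set P)
  · simp only [h, if_true, true_and]
    obtain ⟨x, hx⟩ : ∃ x, IsGreatest (c : Set P) x := by
      obtain ⟨x, hx⟩ := c.exists_maximal hne
      refine ⟨x, hx.1, fun y hy => ?_⟩
      rcases h.2.total hy hx.1 with h1 | h1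
      · exact h1
      · exact hx.2 hy h1
    rw [Finset.sum_eq_single x]
    · rw [if_pos hx]
    · intro y _ hy
      rw [if_neg fun h' => hy (h'.unique hx)]
    · intro h'
      exact absurd (Finset.mem_filter.2 ⟨Finset.mem_univ _, h.1 hx.1⟩) h'
  · simp [h]

open Classical in
/-- The Möbius function `μ(⊥, a)` of the subposet `S` of `P`. -/
noncomputable def mobBot {P : Type*} [PartialOrder P] [OrderBot P] [Finite P] (S : Set P) (a : P) :
    ℤ :=
  if a = ⊥ then 1 else chainSum (S ∩ Set.Ioo ⊥ a)

@[simp]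
theorem mobBot_bot {P : Type*} [PartialOrder P] [OrderBot P] [Finite P] (S : Set P) :
    mobBot S ⊥ = 1 := if_pos rfl

-- Sorting the chains of the open interval below `a` by their largest element `y` contributes
-- `-mobBot S y` for each `y`; the empty chain contributes `-1`, which cancels the term of `⊥`.
open Classical in
theorem sum_mobBot {P : Type*} [PartialOrder P] [OrderBot P] [Fintype P] {S : Set P} (hS : ⊥ ∈ S)
    {a : P} (ha : a ∈ S) (h : a ≠ ⊥) : ∑ y : P with y ∈ S ∧ y ≤ a, mobBot S y = 0 := by
  have h1 : mobBot S a = -1 - ∑ y : P with y ∈ S ∩ Set.Ioo ⊥ a, mobBot S y := by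
    rw [mobBot, if_neg h, chainSum_rec]
    congr 1
    refine Finset.sum_congr (by congr) fun y hy => ?_
    have hy' := (Finset.mem_filter.1 hy).2
    rw [mobBot, if_neg hy'.2.1.ne']
    congr 1
    ext z
    simp only [Set.mem_inter_iff, Set.mem_Ioo, Set.mem_Iio]
    exact ⟨fun hz => ⟨hz.1.1, hz.1.2.1, hz.2⟩,
      fun hz => ⟨⟨hz.1, hz.2.1, hz.2.2.trans hy'.2.2⟩, hz.2.2⟩⟩
  have h2 : (Finset.univ.filter fun y : P => y ∈ S ∧ y ≤ a) =
      insert ⊥ (insert a (Finset.univ.filter fun y : P => y ∈ S ∩ Set.Ioo ⊥ a)) := by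
    ext y
    simp only [Finset.mem_filter, Finset.mem_univ, true_and, Finset.mem_insert, Set.mem_inter_iff,
      Set.mem_Ioo]
    constructor
    · rintro ⟨hy, hya⟩
      by_cases hb : y = ⊥
      · exact Or.inl hb
      by_cases hc : y = a
      · exact Or.inr (Or.inl hc)
      exact Or.inr (Or.inr ⟨hy, bot_lt_iff_ne_bot.2 hb, lt_of_le_of_ne hya hc⟩)
    · rintro (rfl | rfl | hy)
      · exact ⟨hS, bot_le⟩
      · exact ⟨ha, le_rfl⟩
      · exact ⟨hy.1, hy.2.2.le⟩
  rw [h2, Finset.sum_insert (by simp [h.symm]), Finset.sum_insert (by simp), h1, mobBot_bot]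
  ring

-- The relation at `a` determines `f a` from the values below it. This allows a closed formula for
-- the Möbius function to be proved by checking its recursion.
open Classical in
theorem eq_mobBot {P : Type*} [PartialOrder P] [OrderBot P] [Fintype P] {S : Set P} (hS : ⊥ ∈ S)
    (f : P → ℤ) (h0 : f ⊥ = 1)
    (hf : ∀ a ∈ S, a ≠ ⊥ → ∑ y : P with y ∈ S ∧ y ≤ a, f y = 0) :
    ∀ a ∈ S, f a = mobBot S a := by
  intro a
  induction a using WellFoundedLT.induction with
  | ind a ih =>
  intro ha
  by_cases h : a = ⊥
  · rw [h, h0, mobBot_bot]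
  have h1 := hf a ha h
  have h2 := sum_mobBot hS ha h
  have hmem : a ∈ Finset.univ.filter fun y : P => y ∈ S ∧ y ≤ a := by simp [ha]
  rw [← Finset.add_sum_erase _ _ hmem] at h1 h2
  have h3 : ∑ y ∈ (Finset.univ.filter fun y : P => y ∈ S ∧ y ≤ a).erase a, f y =
      ∑ y ∈ (Finset.univ.filter fun y : P => y ∈ S ∧ y ≤ a).erase a, mobBot S y := by
    refine Finset.sum_congr rfl fun y hy => ?_
    simp only [Finset.mem_erase, Finset.mem_filter, Finset.mem_univ, true_and] at hy
    exact ih y (lt_of_le_of_ne hy.2.2 hy.1) hy.2.1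
  linarith

/-- Transport of the Möbius function along an order embedding onto a lower part. -/
theorem mobBot_map {P Q : Type*} [PartialOrder P] [OrderBot P] [Finite P] [PartialOrder Q]
    [OrderBot Q] [Finite Q] (e : P ↪o Q) (he : e ⊥ = ⊥) {S : Set P} {T : Set Q} {a : P}
    (h1 : ∀ x ≤ a, e x ∈ T ↔ x ∈ S) (h2 : ∀ y ∈ T, y ≤ e a → ∃ x, e x = y) :
    mobBot T (e a) = mobBot S a := by
  by_cases ha : a = ⊥
  · subst ha
    rw [he, mobBot_bot, mobBot_bot]
  have hea : e a ≠ ⊥ := fun h => ha (e.injective (h.trans he.symm))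
  rw [mobBot, mobBot, if_neg ha, if_neg hea, ← chainSum_image e]
  congr 1
  ext y
  constructor
  · rintro ⟨hy, hb, hlt⟩
    obtain ⟨x, rfl⟩ := h2 y hy hlt.le
    rw [← he] at hb
    have hlt' := e.lt_iff_lt.1 hlt
    exact ⟨x, ⟨(h1 x hlt'.le).1 hy, e.lt_iff_lt.1 hb, hlt'⟩, rfl⟩
  · rintro ⟨x, ⟨hx, hb, hlt⟩, rfl⟩
    refine ⟨(h1 x hlt.le).2 hx, ?_, e.lt_iff_lt.2 hlt⟩
    rw [← he]
    exact e.lt_iff_lt.2 hb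

theorem mobBot_congr {P : Type*} [PartialOrder P] [OrderBot P] [Finite P] {S T : Set P} {a : P}
    (h : ∀ x ≤ a, x ∈ T ↔ x ∈ S) : mobBot T a = mobBot S a :=
  mobBot_map (RelEmbedding.refl _) rfl h fun y _ _ => ⟨y, rfl⟩

open Classical in
/-- Crapo's complementation theorem for a sublattice of a finite modular lattice. -/
theorem mobBot_top_eq_sum_isCompl {L : Type*} [Lattice L] [BoundedOrder L] [IsModularLattice L]
    [Fintype L] {S : Set L} (hbot : ⊥ ∈ S) (htop : ⊤ ∈ S) (hinf : ∀ a ∈ S, ∀ b ∈ S, a ⊓ b ∈ S)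
    (hsup : ∀ a ∈ S, ∀ b ∈ S, a ⊔ b ∈ S) {c : L} (hc : c ∈ S) :
    mobBot S ⊤ = ∑ d : L with d ∈ S ∧ IsCompl c d, mobBot S c * mobBot S d := by
  -- The formula is extended from `⊤` to every `x`: the sum runs over the `d` that are complements
  -- of `x ⊓ c` in the interval `[⊥, x]`. At `x = ⊤` these are the complements of `c`.
  have key := eq_mobBot hbot
    (fun x => ∑ d : L with d ∈ S ∧ d ⊓ c = ⊥ ∧ d ⊔ x ⊓ c = x, mobBot S (x ⊓ c) * mobBot S d) ?_ ?_
    ⊤ htop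
  · rw [← key]
    simp only [top_inf_eq]
    refine Finset.sum_congr ?_ fun _ _ => rfl
    ext d
    simp only [Finset.mem_filter, Finset.mem_univ, true_and, isCompl_iff, disjoint_iff,
      codisjoint_iff, inf_comm d, sup_comm d]
  · rw [Finset.sum_eq_single ⊥]
    · simp
    · intro d hd hd'
      simp only [Finset.mem_filter, Finset.mem_univ, true_and, bot_inf_eq, sup_bot_eq] at hd
      exact absurd hd.2.2 hd'
    · intro h
      simp [hbot] at h
  · intro z hz hz0
    -- A pair `(x, d)` is recovered from `(x ⊓ c, d)` as `x = (x ⊓ c) ⊔ d`; modularity makes every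
    -- pair `(e, d)` occur, and the double sum factors.
    have hprod : ∑ x : L with x ∈ S ∧ x ≤ z,
        ∑ d : L with d ∈ S ∧ d ⊓ c = ⊥ ∧ d ⊔ x ⊓ c = x, mobBot S (x ⊓ c) * mobBot S d =
        (∑ e : L with e ∈ S ∧ e ≤ z ⊓ c, mobBot S e) *
          ∑ d : L with d ∈ S ∧ d ≤ z ∧ d ⊓ c = ⊥, mobBot S d := by
      rw [Finset.sum_mul_sum, Finset.sum_sigma', ← Finset.sum_product']
      have hmod : ∀ e d : L, e ≤ c → d ⊓ c = ⊥ → (e ⊔ d) ⊓ c = e := fun e d he hd => by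
        rw [sup_inf_assoc_of_le d he, hd, sup_bot_eq]
      refine Finset.sum_bij' (fun p _ => (p.1 ⊓ c, p.2)) (fun p _ => ⟨p.1 ⊔ p.2, p.2⟩) ?_ ?_ ?_ ?_ ?_
      · rintro ⟨x, d⟩ h
        simp only [Finset.mem_sigma, Finset.mem_filter, Finset.mem_univ, true_and,
          Finset.mem_product] at h ⊢
        obtain ⟨⟨hx, hxz⟩, hd, hdc, hdx⟩ := h
        refine ⟨⟨hinf _ hx _ hc, inf_le_inf_right c hxz⟩, hd, ?_, hdc⟩
        exact (le_sup_left.trans hdx.le).trans hxz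
      · rintro ⟨e, d⟩ h
        simp only [Finset.mem_sigma, Finset.mem_filter, Finset.mem_univ, true_and,
          Finset.mem_product] at h ⊢
        obtain ⟨⟨he, hez⟩, hd, hdz, hdc⟩ := h
        refine ⟨⟨hsup _ he _ hd, sup_le (hez.trans inf_le_left) hdz⟩, hd, hdc, ?_⟩
        rw [hmod e d (hez.trans inf_le_right) hdc, sup_comm]
      · rintro ⟨x, d⟩ h
        simp only [Finset.mem_sigma, Finset.mem_filter, Finset.mem_univ, true_and] at h
        simp only [sup_comm _ d, h.2.2.2]
      · rintro ⟨e, d⟩ h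
        simp only [Finset.mem_filter, Finset.mem_univ, true_and, Finset.mem_product] at h
        simp only [hmod e d (h.1.2.trans inf_le_right) h.2.2.2]
      · rintro ⟨x, d⟩ h
        rfl
    rw [hprod]
    -- One factor always vanishes: the second is the full Möbius sum below `z` if `z ⊓ c = ⊥`, and
    -- otherwise the first is the Möbius sum below `z ⊓ c ≠ ⊥`.
    by_cases h : z ⊓ c = ⊥
    · have hall : (Finset.univ.filter fun d : L => d ∈ S ∧ d ≤ z ∧ d ⊓ c = ⊥) =
          Finset.univ.filter fun d : L => d ∈ S ∧ d ≤ z := by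
        ext d
        simp only [Finset.mem_filter, Finset.mem_univ, true_and]
        exact ⟨fun hd => ⟨hd.1, hd.2.1⟩, fun hd => ⟨hd.1, hd.2,
          le_bot_iff.1 ((inf_le_inf_right c hd.2).trans h.le)⟩⟩
      rw [hall, sum_mobBot hbot hz hz0, mul_zero]
    · rw [sum_mobBot hbot (hinf _ hz _ hc) h, zero_mul]

end Moebius

/-! ### Lattices of invariant submodules. -/

section Invariant

variable {ι R N : Type*} [Ring R] [AddCommGroup N] [Module R N]

instance finite_linearEquiv {N' : Type*} [AddCommGroup N'] [Module R N'] [Finite N] [Finite N'] :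
    Finite (N ≃ₗ[R] N') :=
  Finite.of_injective (fun g : N ≃ₗ[R] N' => (g : N → N')) DFunLike.coe_injective

/-- The submodules invariant under every member of a family of automorphisms. -/
def invSub (x : ι → N ≃ₗ[R] N) : Set (Submodule R N) :=
  {U | ∀ i u, x i u ∈ U ↔ u ∈ U}

theorem map_eq_iff_forall_mem_iff (g : N ≃ₗ[R] N) (U : Submodule R N) :
    U.map (g : N →ₗ[R] N) = U ↔ ∀ u, g u ∈ U ↔ u ∈ U := by
  constructor
  · intro h u
    constructor
    · intro hu
      rw [← h] at hu
      obtain ⟨v, hv, hvu⟩ := hu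
      rwa [← g.injective hvu]
    · intro hu
      rw [← h]
      exact ⟨u, hu, rfl⟩
  · intro h
    ext u
    constructor
    · rintro ⟨v, hv, rfl⟩
      exact (h v).2 hv
    · intro hu
      refine ⟨g.symm u, (h _).1 ?_, ?_⟩ <;> simp [hu]

theorem mem_invSub_iff_map {x : ι → N ≃ₗ[R] N} {U : Submodule R N} :
    U ∈ invSub x ↔ ∀ i, U.map (x i : N →ₗ[R] N) = U :=
  forall_congr' fun i => (map_eq_iff_forall_mem_iff (x i) U).symm

/-- An injective self-map of the finite set `U` is onto, so stability in one direction suffices. -/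
theorem forall_mem_iff_of_forall_mem [Finite N] {g : N ≃ₗ[R] N} {U : Submodule R N}
    (h : ∀ u ∈ U, g u ∈ U) (u : N) : g u ∈ U ↔ u ∈ U := by
  refine ⟨fun hu => ?_, h u⟩
  have hinj : Function.Injective (fun v : U => (⟨g v, h v v.2⟩ : U)) := fun v w hvw =>
    Subtype.ext (g.injective (congrArg Subtype.val hvw))
  obtain ⟨v, hv⟩ := (Finite.injective_iff_surjective.1 hinj) ⟨g u, hu⟩
  have : (v : N) = u := g.injective (congrArg Subtype.val hv)
  exact this ▸ v.2

theorem bot_mem_invSub (x : ι → N ≃ₗ[R] N) : ⊥ ∈ invSub x := fun i u => by simp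

theorem top_mem_invSub (x : ι → N ≃ₗ[R] N) : ⊤ ∈ invSub x := fun i u => by simp

theorem inf_mem_invSub {x : ι → N ≃ₗ[R] N} {U W : Submodule R N} (hU : U ∈ invSub x)
    (hW : W ∈ invSub x) : U ⊓ W ∈ invSub x := fun i u => by
  simp only [Submodule.mem_inf, hU i u, hW i u]

theorem sup_mem_invSub {x : ι → N ≃ₗ[R] N} {U W : Submodule R N} (hU : U ∈ invSub x)
    (hW : W ∈ invSub x) : U ⊔ W ∈ invSub x := by
  rw [mem_invSub_iff_map] at *
  intro i
  rw [Submodule.map_sup, hU i, hW i]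

/-- The Möbius number of the lattice of submodules invariant under a family of automorphisms. -/
noncomputable def muInv [Finite N] (x : ι → N ≃ₗ[R] N) : ℤ := mobBot (invSub x) ⊤

/-- The number of vectors contained in no proper invariant submodule. -/
noncomputable def cycCard (x : ι → N ≃ₗ[R] N) : ℕ :=
  Nat.card {v : N // ∀ U ∈ invSub x, v ∈ U → U = ⊤}

/-- A finite lattice of submodules is determined by the underlying subsets. -/
theorem mobBot_top_eq_of_addEquiv {R' N' : Type*} [Ring R'] [AddCommGroup N'] [Module R' N']
    [Finite N] [Finite N'] (f : N ≃+ N') {S : Set (Submodule R N)} {T : Set (Submodule R' N')}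
    (h1 : ∀ U ∈ S, ∃ U' ∈ T, ∀ n, f n ∈ U' ↔ n ∈ U)
    (h2 : ∀ U' ∈ T, ∃ U ∈ S, ∀ n, f n ∈ U' ↔ n ∈ U) :
    mobBot S ⊤ = mobBot T ⊤ := by
  have hbt : (⊤ : Submodule R N) = ⊥ ↔ (⊤ : Submodule R' N') = ⊥ := by
    rw [Submodule.eq_bot_iff, Submodule.eq_bot_iff]
    constructor
    · intro h n' _
      have := h (f.symm n') trivial
      simpa using this
    · intro h n _
      have := h (f n) trivial
      simpa using this
  unfold mobBot
  by_cases hb : (⊤ : Submodule R N) = ⊥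
  · rw [if_pos hb, if_pos (hbt.1 hb)]
  rw [if_neg hb, if_neg (fun h => hb (hbt.2 h))]
  choose! e he1 he2 using h1
  have hle : ∀ U ∈ S, ∀ W ∈ S, e U ≤ e W ↔ U ≤ W := by
    intro U hU W hW
    constructor
    · intro h n hn
      exact (he2 W hW n).1 (h ((he2 U hU n).2 hn))
    · intro h n' hn'
      obtain ⟨n, rfl⟩ := f.surjective n'
      exact (he2 W hW n).2 (h ((he2 U hU n).1 hn'))
  -- The chosen map `e` is controlled only on `S`, so both open intervals are presented as images of
  -- the subtype `S'`.
  let S' : Set (Submodule R N) := S ∩ Set.Ioo ⊥ ⊤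
  let φ : S' ↪o Submodule R' N' :=
    OrderEmbedding.ofMapLEIff (fun U => e U.1) fun U W => hle U.1 U.2.1 W.1 W.2.1
  have e1 : S ∩ Set.Ioo ⊥ ⊤ = (OrderEmbedding.subtype (· ∈ S')) '' Set.univ := by
    rw [Set.image_univ]
    exact Subtype.range_coe.symm
  have e2 : T ∩ Set.Ioo ⊥ ⊤ = φ '' Set.univ := by
    rw [Set.image_univ]
    have hbot : ∀ U ∈ S, U = ⊥ ↔ e U = ⊥ := by
      intro U hU
      rw [Submodule.eq_bot_iff, Submodule.eq_bot_iff]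
      constructor
      · intro h n' hn'
        obtain ⟨n, rfl⟩ := f.surjective n'
        rw [h n ((he2 U hU n).1 hn'), map_zero]
      · intro h n hn
        have := h (f n) ((he2 U hU n).2 hn)
        simpa using this
    have htop : ∀ U ∈ S, U = ⊤ ↔ e U = ⊤ := by
      intro U hU
      rw [Submodule.eq_top_iff', Submodule.eq_top_iff']
      constructor
      · intro h n'
        obtain ⟨n, rfl⟩ := f.surjective n'
        exact (he2 U hU n).2 (h n)
      · intro h n
        exact (he2 U hU n).1 (h (f n))
    ext U'
    constructor
    · rintro ⟨hT, hb', ht'⟩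
      obtain ⟨U, hU, hU'⟩ := h2 U' hT
      have heU : e U = U' := by
        ext n'
        obtain ⟨n, rfl⟩ := f.surjective n'
        rw [he2 U hU, hU']
      subst heU
      refine ⟨⟨U, hU, bot_lt_iff_ne_bot.2 fun h => ?_, lt_top_iff_ne_top.2 fun h => ?_⟩, rfl⟩
      · exact hb'.ne' ((hbot U hU).1 h)
      · exact ht'.ne ((htop U hU).1 h)
    · rintro ⟨⟨U, hU, hb', ht'⟩, rfl⟩
      refine ⟨he1 U hU, bot_lt_iff_ne_bot.2 fun h => ?_, lt_top_iff_ne_top.2 fun h => ?_⟩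
      · exact hb'.ne' ((hbot U hU).2 h)
      · exact ht'.ne ((htop U hU).2 h)
  rw [e1, e2, chainSum_image, chainSum_image]

theorem cycCard_eq_of_addEquiv {ι' R' N' : Type*} [Ring R'] [AddCommGroup N'] [Module R' N']
    (f : N ≃+ N') {x : ι → N ≃ₗ[R] N} {y : ι' → N' ≃ₗ[R'] N'}
    (h1 : ∀ U ∈ invSub x, ∃ U' ∈ invSub y, ∀ n, f n ∈ U' ↔ n ∈ U)
    (h2 : ∀ U' ∈ invSub y, ∃ U ∈ invSub x, ∀ n, f n ∈ U' ↔ n ∈ U) :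
    cycCard x = cycCard y := by
  refine Nat.card_congr (f.toEquiv.subtypeEquiv fun v => ?_)
  constructor
  · intro h U' hU' hv
    obtain ⟨U, hU, hUU⟩ := h2 U' hU'
    have := h U hU ((hUU v).1 hv)
    rw [Submodule.eq_top_iff'] at this ⊢
    intro n'
    obtain ⟨n, rfl⟩ := f.surjective n'
    exact (hUU n).2 (this n)
  · intro h U hU hv
    obtain ⟨U', hU', hUU⟩ := h1 U hU
    have := h U' hU' ((hUU v).2 hv)
    rw [Submodule.eq_top_iff'] at this ⊢
    intro n
    exact (hUU n).1 (this (f n))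

/-- The invariant submodules below `U` are those of the restricted family; this is what lets Möbius
sums be evaluated on smaller modules. -/
theorem mobBot_invSub_eq_muInv [Finite N] {x : ι → N ≃ₗ[R] N} {U : Submodule R N}
    {y : ι → U ≃ₗ[R] U} (h : ∀ i u, (y i u : N) = x i u) : mobBot (invSub x) U = muInv y := by
  have := mobBot_map (Submodule.MapSubtype.orderEmbedding U) (S := invSub y) (T := invSub x)
    (a := ⊤) ?_ ?_ ?_
  · rw [Submodule.map_subtype_embedding_eq, Submodule.map_subtype_top] at this
    exact this
  · rw [Submodule.map_subtype_embedding_eq, Submodule.map_bot]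
  · intro W _
    rw [Submodule.map_subtype_embedding_eq]
    constructor
    · intro hW i u
      have := hW i u
      rw [← h i u] at this
      simpa using this
    · intro hW i u
      by_cases hu : u ∈ U
      · have := hW i ⟨u, hu⟩
        have h1 := h i ⟨u, hu⟩
        simp only at h1
        rw [← h1]
        simp only [Submodule.mem_map, Submodule.subtype_apply, Subtype.exists, exists_and_right,
          exists_eq_right, hu, exists_true_left, SetLike.coe_mem, Subtype.coe_eta]
        exact this
      · have hxu : x i u ∉ U := by
          intro hxu
          have h1 := h i ((y i).symm ⟨x i u, hxu⟩)
          rw [LinearEquiv.apply_symm_apply] at h1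
          exact hu ((x i).injective h1 ▸ Subtype.property _)
        constructor
        · rintro ⟨v, _, hv⟩
          exact absurd (hv ▸ v.2) hxu
        · rintro ⟨v, _, hv⟩
          exact absurd (hv ▸ v.2) hu
  · intro W _ hWU
    rw [Submodule.map_subtype_embedding_eq, Submodule.map_subtype_top] at hWU
    exact ⟨W.comap U.subtype, by
      rw [Submodule.map_subtype_embedding_eq, Submodule.map_comap_subtype]
      exact inf_eq_right.2 hWU⟩

end Invariant

/-! ### Commuting families, their restrictions and their gluing along direct sums. -/

section CommTuple

variable (ι R N : Type*) [Ring R] [AddCommGroup N] [Module R N]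

/-- Families of pairwise commuting automorphisms. -/
abbrev CommTuple : Type _ := {x : ι → N ≃ₗ[R] N // ∀ i j, Commute (x i) (x j)}

variable {ι R N}

/-- Restriction of a commuting family to an invariant submodule. -/
def CommTuple.restrict (x : CommTuple ι R N) (U : Submodule R N) (hU : U ∈ invSub x.1) :
    CommTuple ι R U :=
  ⟨fun i => (x.1 i).ofSubmodules U U (mem_invSub_iff_map.1 hU i), fun i j => by
    ext u
    exact LinearEquiv.congr_fun (x.2 i j) (u : N)⟩

@[simp]
theorem CommTuple.coe_restrict_apply (x : CommTuple ι R N) (U : Submodule R N)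
    (hU : U ∈ invSub x.1) (i : ι) (u : U) : (((x.restrict U hU).1 i u : U) : N) = x.1 i u := rfl

/-- The automorphism of a direct sum with given restrictions to the two summands. -/
noncomputable def glue {C D : Submodule R N} (h : IsCompl C D) (a : C ≃ₗ[R] C) (b : D ≃ₗ[R] D) :
    N ≃ₗ[R] N :=
  (Submodule.prodEquivOfIsCompl C D h).symm ≪≫ₗ a.prodCongr b ≪≫ₗ Submodule.prodEquivOfIsCompl C D h

theorem glue_add {C D : Submodule R N} (h : IsCompl C D) (a : C ≃ₗ[R] C) (b : D ≃ₗ[R] D) (c : C)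
    (d : D) : glue h a b (c + d) = a c + b d := by
  have : (Submodule.prodEquivOfIsCompl C D h).symm (c + d) = (c, d) := by
    rw [LinearEquiv.symm_apply_eq, Submodule.coe_prodEquivOfIsCompl']
  rw [glue, LinearEquiv.trans_apply, LinearEquiv.trans_apply, this,
    Submodule.coe_prodEquivOfIsCompl']
  rfl

theorem glue_left {C D : Submodule R N} (h : IsCompl C D) (a : C ≃ₗ[R] C) (b : D ≃ₗ[R] D) (c : C) :
    glue h a b c = a c := by
  simpa using glue_add h a b c 0

theorem glue_right {C D : Submodule R N} (h : IsCompl C D) (a : C ≃ₗ[R] C) (b : D ≃ₗ[R] D) (d : D) :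
    glue h a b d = b d := by
  simpa using glue_add h a b 0 d

theorem exists_add_of_isCompl {C D : Submodule R N} (h : IsCompl C D) (n : N) :
    ∃ (c : C) (d : D), (c : N) + d = n := by
  have : n ∈ C ⊔ D := h.sup_eq_top ▸ trivial
  obtain ⟨c, hc, d, hd, hcd⟩ := Submodule.mem_sup.1 this
  exact ⟨⟨c, hc⟩, ⟨d, hd⟩, hcd⟩

theorem linearEquiv_ext_of_isCompl {C D : Submodule R N} (h : IsCompl C D) {f g : N ≃ₗ[R] N}
    (hC : ∀ c : C, f c = g c) (hD : ∀ d : D, f d = g d) : f = g := by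
  ext n
  obtain ⟨c, d, rfl⟩ := exists_add_of_isCompl h n
  rw [map_add, map_add, hC, hD]

theorem left_mem_invSub_glue {C D : Submodule R N} (h : IsCompl C D) (y : ι → C ≃ₗ[R] C)
    (z : ι → D ≃ₗ[R] D) : C ∈ invSub fun i => glue h (y i) (z i) := by
  rw [mem_invSub_iff_map]
  intro i
  apply le_antisymm
  · rintro _ ⟨c, hc, rfl⟩
    have := glue_left h (y i) (z i) ⟨c, hc⟩
    simp only at this
    simp [this]
  · intro c hc
    refine ⟨(y i).symm ⟨c, hc⟩, Subtype.property _, ?_⟩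
    simp [glue_left]

theorem right_mem_invSub_glue {C D : Submodule R N} (h : IsCompl C D) (y : ι → C ≃ₗ[R] C)
    (z : ι → D ≃ₗ[R] D) : D ∈ invSub fun i => glue h (y i) (z i) := by
  rw [mem_invSub_iff_map]
  intro i
  apply le_antisymm
  · rintro _ ⟨c, hc, rfl⟩
    have := glue_right h (y i) (z i) ⟨c, hc⟩
    simp only at this
    simp [this]
  · intro c hc
    refine ⟨(z i).symm ⟨c, hc⟩, Subtype.property _, ?_⟩
    simp [glue_right]

/-- Commuting families that preserve both summands of a direct sum are pairs of commuting families
on the summands. -/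
noncomputable def CommTuple.splitEquiv {C D : Submodule R N} (h : IsCompl C D) :
    {x : CommTuple ι R N // C ∈ invSub x.1 ∧ D ∈ invSub x.1} ≃
      CommTuple ι R C × CommTuple ι R D where
  toFun x := (x.1.restrict C x.2.1, x.1.restrict D x.2.2)
  invFun p := ⟨⟨fun i => glue h (p.1.1 i) (p.2.1 i), fun i j => by
    refine linearEquiv_ext_of_isCompl h (fun c => ?_) (fun d => ?_)
    · rw [LinearEquiv.mul_apply, LinearEquiv.mul_apply]
      simp only [glue_left]
      exact congrArg Subtype.val (LinearEquiv.congr_fun (p.1.2 i j) c)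
    · rw [LinearEquiv.mul_apply, LinearEquiv.mul_apply]
      simp only [glue_right]
      exact congrArg Subtype.val (LinearEquiv.congr_fun (p.2.2 i j) d)⟩,
    left_mem_invSub_glue h _ _, right_mem_invSub_glue h _ _⟩
  left_inv x := by
    refine Subtype.ext (Subtype.ext (funext fun i => ?_))
    refine linearEquiv_ext_of_isCompl h (fun c => ?_) (fun d => ?_)
    · simp only [glue_left, CommTuple.coe_restrict_apply]
    · simp only [glue_right, CommTuple.coe_restrict_apply]
  right_inv p := by
    refine Prod.ext ?_ ?_
    · refine Subtype.ext (funext fun i => LinearEquiv.ext fun c => Subtype.ext ?_)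
      rw [CommTuple.coe_restrict_apply]
      exact glue_left _ _ _ _
    · refine Subtype.ext (funext fun i => LinearEquiv.ext fun c => Subtype.ext ?_)
      rw [CommTuple.coe_restrict_apply]
      exact glue_right _ _ _ _

-- Families preserving `C` and `D` correspond to independent pairs of families on the summands, so a
-- summand that factors gives a product of sums.
open Classical in
theorem CommTuple.sum_split [Fintype (CommTuple ι R N)] {C D : Submodule R N}
    [Fintype (CommTuple ι R C)] [Fintype (CommTuple ι R D)] (h : IsCompl C D)
    (f : CommTuple ι R C → ℤ) (g : CommTuple ι R D → ℤ) (F : CommTuple ι R N → ℤ)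
    (hF : ∀ x (hC : C ∈ invSub x.1) (hD : D ∈ invSub x.1),
      F x = f (x.restrict C hC) * g (x.restrict D hD)) :
    ∑ x : CommTuple ι R N with C ∈ invSub x.1 ∧ D ∈ invSub x.1, F x = (∑ y, f y) * ∑ z, g z := by
  rw [Finset.sum_mul_sum, ← Fintype.sum_prod_type', ← (CommTuple.splitEquiv h).sum_comp]
  rw [Finset.sum_subtype (p := fun x : CommTuple ι R N => C ∈ invSub x.1 ∧ D ∈ invSub x.1) _
    (by simp)]
  exact Finset.sum_congr rfl fun x _ => hF x.1 x.2.1 x.2.2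

open Classical in
/-- Crapo's theorem for the lattice of invariant submodules. -/
theorem CommTuple.muInv_eq_sum [Finite N] [Fintype (Submodule R N)] (x : CommTuple ι R N)
    {C : Submodule R N} (hC : C ∈ invSub x.1) :
    muInv x.1 = ∑ D : Submodule R N with D ∈ invSub x.1 ∧ IsCompl C D,
      muInv (x.restrict C hC).1 * (if hD : D ∈ invSub x.1 then muInv (x.restrict D hD).1 else 0) := by
  rw [muInv, mobBot_top_eq_sum_isCompl (bot_mem_invSub _) (top_mem_invSub _)
    (fun a ha b hb => inf_mem_invSub ha hb) (fun a ha b hb => sup_mem_invSub ha hb) hC]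
  refine Finset.sum_congr rfl fun D hD => ?_
  have hD' := (Finset.mem_filter.1 hD).2.1
  rw [dif_pos hD', mobBot_invSub_eq_muInv (y := (x.restrict C hC).1) (fun _ _ => rfl),
    mobBot_invSub_eq_muInv (y := (x.restrict D hD').1) (fun _ _ => rfl)]

end CommTuple

/-! ### Sums of Möbius numbers over commuting families. -/

section TupleSum

/-- The sum of the Möbius numbers over all commuting families of automorphisms. -/
noncomputable def tupleSum (ι R N : Type*) [Ring R] [AddCommGroup N] [Module R N] [Finite ι]
    [Finite N] : ℤ :=
  ∑ᶠ x : CommTuple ι R N, muInv x.1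

theorem tupleSum_eq (ι R N : Type*) [Ring R] [AddCommGroup N] [Module R N] [Finite ι]
    [Finite N] [Fintype (CommTuple ι R N)] : tupleSum ι R N = ∑ x : CommTuple ι R N, muInv x.1 :=
  finsum_eq_sum_of_fintype _

/-- The commuting family with a single member. -/
def CommTuple.single {R N : Type*} [Ring R] [AddCommGroup N] [Module R N] :
    (N ≃ₗ[R] N) ≃ CommTuple Unit R N where
  toFun g := ⟨fun _ => g, fun _ _ => Commute.refl g⟩
  invFun x := x.1 ()
  left_inv _ := rfl
  right_inv _ := rfl

end TupleSum

/-! ### One automorphism of a vector space. -/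

section VectorSpace

variable {k W : Type*} [Field k] [AddCommGroup W] [Module k W]

theorem mobBot_of_finrank_eq_one [Finite W] {S : Set (Submodule k W)} {U : Submodule k W}
    (hU : Module.finrank k U = 1) : mobBot S U = -1 := by
  have := Fintype.ofFinite (Submodule k W)
  have hatom : IsAtom U := by
    rwa [← isSimpleModule_iff_isAtom, isSimpleModule_iff_finrank_eq_one]
  rw [mobBot, if_neg hatom.1]
  have : S ∩ Set.Ioo ⊥ U = ∅ := by
    ext y
    simp only [Set.mem_inter_iff, Set.mem_Ioo, Set.mem_empty_iff_false, iff_false]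
    rintro ⟨-, h1, h2⟩
    exact h1.ne' (hatom.2 y h2)
  rw [this, chainSum_rec]
  simp

theorem exists_map_eq_of_linearEquiv {U U' D D' : Submodule k W} (h : IsCompl U D)
    (h' : IsCompl U' D') (e : U ≃ₗ[k] U') (f : D ≃ₗ[k] D') :
    ∃ g : W ≃ₗ[k] W, U.map (g : W →ₗ[k] W) = U' := by
  refine ⟨(Submodule.prodEquivOfIsCompl U D h).symm ≪≫ₗ e.prodCongr f ≪≫ₗ
    Submodule.prodEquivOfIsCompl U' D' h', ?_⟩
  have hg : ∀ u : U, ((Submodule.prodEquivOfIsCompl U D h).symm ≪≫ₗ e.prodCongr f ≪≫ₗ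
      Submodule.prodEquivOfIsCompl U' D' h') (u : W) = e u := fun u => by
    rw [LinearEquiv.trans_apply, LinearEquiv.trans_apply,
      Submodule.prodEquivOfIsCompl_symm_apply_left, Submodule.coe_prodEquivOfIsCompl']
    simp
  ext w
  constructor
  · rintro ⟨u, hu, rfl⟩
    have := hg ⟨u, hu⟩
    exact this ▸ Subtype.property _
  · intro hw
    refine ⟨e.symm ⟨w, hw⟩, Subtype.property _, ?_⟩
    have := hg (e.symm ⟨w, hw⟩)
    rw [e.apply_symm_apply] at this
    exact this

theorem exists_map_eq_of_finrank_eq [Finite W] {U U' : Submodule k W}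
    (h : Module.finrank k U = Module.finrank k U') :
    ∃ g : W ≃ₗ[k] W, U.map (g : W →ₗ[k] W) = U' := by
  have : Module.Finite k W := Module.Finite.of_finite
  obtain ⟨D, hD⟩ := U.exists_isCompl
  obtain ⟨D', hD'⟩ := U'.exists_isCompl
  have h1 := Submodule.finrank_add_eq_of_isCompl hD
  have h2 := Submodule.finrank_add_eq_of_isCompl hD'
  exact exists_map_eq_of_linearEquiv hD hD' (LinearEquiv.ofFinrankEq _ _ h)
    (LinearEquiv.ofFinrankEq _ _ (by omega))

open Classical in
/-- The general linear group acts transitively on the lines. -/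
theorem sum_card_filter_mem_invSub_of_finrank_eq_one [Finite W] [Fintype (Submodule k W)]
    [Fintype (CommTuple Unit k W)] (hW : 1 ≤ Module.finrank k W) :
    ∑ U ∈ Finset.univ.filter fun U : Submodule k W => Module.finrank k U = 1,
      (Finset.univ.filter fun x : CommTuple Unit k W => U ∈ invSub x.1).card =
    Fintype.card (CommTuple Unit k W) := by
  have : Module.Finite k W := Module.Finite.of_finite
  have : Nontrivial W := Module.nontrivial_of_finrank_pos (R := k) hW
  obtain ⟨w, hw⟩ := exists_ne (0 : W)
  let U₀ : Submodule k W := Submodule.span k {w}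
  have hU₀ : Module.finrank k U₀ = 1 := finrank_span_singleton hw
  -- Automorphisms are sorted by the image of the fixed line `U₀`. If `h` carries `U₀` to `U`, right
  -- multiplication by `h` sends the stabilizer of `U` onto the fibre over `U`.
  rw [← Finset.card_univ, Finset.card_eq_sum_card_fiberwise
    (f := fun x : CommTuple Unit k W => U₀.map (x.1 () : W →ₗ[k] W))
    (t := Finset.univ.filter fun U : Submodule k W => Module.finrank k U = 1)]
  · refine Finset.sum_congr rfl fun U hU => ?_
    have hU' := (Finset.mem_filter.1 hU).2
    obtain ⟨h, hh⟩ := exists_map_eq_of_finrank_eq (hU₀.trans hU'.symm)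
    refine Finset.card_bij (fun x _ => CommTuple.single (x.1 () * h)) ?_ ?_ ?_
    · intro x hx
      simp only [Finset.mem_filter, Finset.mem_univ, true_and, mem_invSub_iff_map] at hx ⊢
      have h1 := hx ()
      conv_rhs => rw [← h1, ← hh, ← Submodule.map_comp]
      rfl
    · intro x _ y _ hxy
      have := CommTuple.single.injective hxy
      exact Subtype.ext (funext fun _ => mul_right_cancel this)
    · intro y hy
      simp only [Finset.mem_filter, Finset.mem_univ, true_and] at hy
      refine ⟨CommTuple.single (y.1 () * h⁻¹), ?_, ?_⟩
      · simp only [Finset.mem_filter, Finset.mem_univ, true_and, mem_invSub_iff_map]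
        rintro ⟨⟩
        conv_lhs => rw [← hh, ← Submodule.map_comp]
        conv_rhs => rw [← hy]
        congr 1
        ext v
        change y.1 () (h.symm (h v)) = y.1 () v
        simp
      · apply Subtype.ext
        funext
        change y.1 () * h⁻¹ * h = _
        simp
  · intro x _
    simp only [Finset.coe_filter, Finset.mem_univ, true_and, Set.mem_ofPred_eq]
    rw [← hU₀]
    exact LinearEquiv.finrank_map_eq (x.1 ()) U₀

open Classical in
/-- Every automorphism of a subspace has the same number of extensions. -/
theorem exists_sum_restrict_eq_mul [Fintype (CommTuple Unit k W)] (U : Submodule k W)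
    [Fintype (CommTuple Unit k U)] (f : CommTuple Unit k U → ℤ) :
    ∃ m : ℕ, ∑ x : {x : CommTuple Unit k W // U ∈ invSub x.1}, f (x.1.restrict U x.2) =
      m * ∑ y, f y := by
  obtain ⟨D, hD⟩ := U.exists_isCompl
  let ρ : {x : CommTuple Unit k W // U ∈ invSub x.1} → CommTuple Unit k U :=
    fun x => x.1.restrict U x.2
  have hle : ∀ y y' : CommTuple Unit k U,
      (Finset.univ.filter fun x => ρ x = y).card ≤ (Finset.univ.filter fun x => ρ x = y').card := by
    intro y y'
    -- Left multiplication by this `h`, the identity on `D`, injects the extensions of `y` into the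
    -- extensions of `y'`.
    let h : W ≃ₗ[k] W := glue hD (y'.1 () * (y.1 ())⁻¹) 1
    have hinv : U ∈ invSub (fun _ : Unit => h) := left_mem_invSub_glue hD _ _
    refine Finset.card_le_card_of_injOn
      (fun x => ⟨CommTuple.single (h * x.1.1 ()), fun i u => ?_⟩) ?_ ?_
    · exact (hinv () (x.1.1 () u)).trans (x.2 () u)
    · intro x hx
      simp only [Finset.coe_filter, Finset.mem_univ, true_and, Set.mem_ofPred_eq] at hx ⊢
      refine Subtype.ext (funext fun _ => LinearEquiv.ext fun u => Subtype.ext ?_)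
      change h (x.1.1 () u) = _
      have h1 : x.1.1 () u = (y.1 () u : W) := by
        rw [← hx]
        rfl
      rw [h1]
      change glue hD _ _ _ = _
      rw [glue_left, LinearEquiv.mul_apply]
      congr 2
      exact (y.1 ()).symm_apply_apply u
    · intro x _ x' _ hxx
      have := CommTuple.single.injective (congrArg Subtype.val hxx)
      exact Subtype.ext (Subtype.ext (funext fun _ => mul_left_cancel this))
  refine ⟨(Finset.univ.filter fun x => ρ x = CommTuple.single 1).card, ?_⟩
  rw [← Finset.sum_fiberwise Finset.univ ρ, Finset.mul_sum]
  refine Finset.sum_congr rfl fun y _ => ?_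
  rw [Finset.sum_congr rfl (g := fun _ => f y), Finset.sum_const, nsmul_eq_mul,
    le_antisymm (hle y (CommTuple.single 1)) (hle (CommTuple.single 1) y)]
  intro x hx
  exact congrArg f (Finset.mem_filter.1 hx).2

end VectorSpace

open Classical in
/-- The first equivariant reduced Euler characteristic vanishes in dimension at least `2`. -/
theorem tupleSum_unit_eq_zero (k : Type*) [Field k] (n : ℕ) :
    ∀ (W : Type u) [AddCommGroup W] [Module k W] [Finite W],
      Module.finrank k W = n → 2 ≤ n → tupleSum Unit k W = 0 := by
  induction n using Nat.strong_induction_on with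
  | _ n ih =>
  intro W _ _ _ hn h2
  have : Module.Finite k W := Module.Finite.of_finite
  have := Fintype.ofFinite (Submodule k W)
  have := Fintype.ofFinite (CommTuple Unit k W)
  have hbt : (⊤ : Submodule k W) ≠ ⊥ := by
    intro h
    have h1 := finrank_top k W
    rw [h, finrank_bot] at h1
    omega
  -- The Möbius relation at `⊤` is summed over all automorphisms and regrouped by the subspace `U`.
  have hzero : ∑ x : CommTuple Unit k W,
      ∑ U : Submodule k W with U ∈ invSub x.1, mobBot (invSub x.1) U = 0 := by
    refine Finset.sum_eq_zero fun x _ => ?_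
    have := sum_mobBot (bot_mem_invSub x.1) (top_mem_invSub x.1) hbt
    simpa using this
  simp only [Finset.sum_filter] at hzero
  rw [Finset.sum_comm] at hzero
  -- Subspaces with dimension strictly between 1 and `n` contribute zero by induction. The zero
  -- subspace contributes `|GL|` and the lines together `-|GL|`, which leaves the contribution of
  -- `⊤`.
  have hterm : ∀ U : Submodule k W,
      ∑ x : CommTuple Unit k W, (if U ∈ invSub x.1 then mobBot (invSub x.1) U else 0) =
      (if U = ⊥ then (Fintype.card (CommTuple Unit k W) : ℤ) else 0) +
      (if Module.finrank k U = 1 then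
        -((Finset.univ.filter fun x : CommTuple Unit k W => U ∈ invSub x.1).card : ℤ) else 0) +
      (if U = ⊤ then tupleSum Unit k W else 0) := by
    intro U
    by_cases h0 : U = ⊥
    · subst h0
      simp [bot_mem_invSub, hbt.symm]
    by_cases ht : U = ⊤
    · subst ht
      have : ¬ n = 1 := by omega
      simp [top_mem_invSub, hbt, tupleSum_eq, muInv, hn, this]
    by_cases h1 : Module.finrank k U = 1
    · rw [if_neg h0, if_neg ht, if_pos h1, ← Finset.sum_filter,
        Finset.sum_congr rfl fun x _ => mobBot_of_finrank_eq_one h1]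
      simp
    · rw [if_neg h0, if_neg ht, if_neg h1, ← Finset.sum_filter]
      have hpos : Module.finrank k U ≠ 0 := fun h => h0 (Submodule.finrank_eq_zero.1 h)
      have hlt : Module.finrank k U < n := hn ▸ Submodule.finrank_lt ht
      have hU := ih _ hlt U rfl (by omega)
      have := Fintype.ofFinite (CommTuple Unit k U)
      rw [tupleSum_eq] at hU
      obtain ⟨m, hm⟩ := exists_sum_restrict_eq_mul U fun y => muInv y.1
      rw [hU, mul_zero] at hm
      rw [Finset.sum_subtype (p := fun x : CommTuple Unit k W => U ∈ invSub x.1) _ (by simp)]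
      simp only [add_zero]
      rw [← hm]
      exact Finset.sum_congr rfl fun x _ => mobBot_invSub_eq_muInv fun _ _ => rfl
  simp only [hterm] at hzero
  rw [Finset.sum_add_distrib, Finset.sum_add_distrib, ← Finset.sum_filter (p := fun U =>
    Module.finrank k _ = 1), Finset.sum_neg_distrib, ← Nat.cast_sum,
    sum_card_filter_mem_invSub_of_finrank_eq_one (by rw [hn]; omega)] at hzero
  simpa using hzero

/-! ### One automorphism of a finite module over a commutative ring. -/

section Cyclic

variable {R : Type*} [CommRing R]

/-- Every automorphism of a cyclic module is multiplication by a scalar, so it preserves all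
submodules, and evaluation at `v` matches automorphisms with generators. -/
theorem tupleSum_unit_of_span_eq_top {N : Type*} [AddCommGroup N] [Module R N] [Finite N]
    {v : N} (hv : Submodule.span R {v} = ⊤) :
    tupleSum Unit R N = Nat.card {w : N // Submodule.span R {w} = ⊤} *
      mobBot (Set.univ : Set (Submodule R N)) ⊤ := by
  have := Fintype.ofFinite (CommTuple Unit R N)
  have hmem : ∀ n : N, ∃ r : R, r • v = n := fun n =>
    Submodule.mem_span_singleton.1 (hv ▸ trivial)
  have hscalar : ∀ g : N ≃ₗ[R] N, ∃ r : R, ∀ n, g n = r • n := by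
    intro g
    obtain ⟨r, hr⟩ := hmem (g v)
    refine ⟨r, fun n => ?_⟩
    obtain ⟨s, rfl⟩ := hmem n
    rw [map_smul, ← hr, smul_comm]
  have hinv : ∀ x : CommTuple Unit R N, invSub x.1 = Set.univ := by
    intro x
    refine Set.eq_univ_of_forall fun U i => forall_mem_iff_of_forall_mem fun u hu => ?_
    obtain ⟨r, hr⟩ := hscalar (x.1 i)
    rw [hr]
    exact U.smul_mem r hu
  have hspan : ∀ g : N ≃ₗ[R] N, Submodule.span R {g v} = ⊤ := by
    intro g
    have := congrArg (Submodule.map (g : N →ₗ[R] N)) hv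
    rw [Submodule.map_span, Set.image_singleton, Submodule.map_top, LinearEquiv.range] at this
    exact this
  have hbij : Function.Bijective
      (fun g : N ≃ₗ[R] N => (⟨g v, hspan g⟩ : {w : N // Submodule.span R {w} = ⊤})) := by
    constructor
    · intro g g' h
      have h' : g v = g' v := congrArg Subtype.val h
      ext n
      obtain ⟨s, rfl⟩ := hmem n
      rw [map_smul, map_smul, h']
    · rintro ⟨w, hw⟩
      obtain ⟨r, hr⟩ := hmem w
      have hsurj : Function.Surjective (LinearMap.lsmul R N r) := by
        intro n
        obtain ⟨s, hs⟩ := Submodule.mem_span_singleton.1 (hw ▸ trivial : n ∈ Submodule.span R {w})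
        refine ⟨s • v, ?_⟩
        rw [LinearMap.lsmul_apply, smul_comm, hr, hs]
      refine ⟨LinearEquiv.ofBijective _ ⟨Finite.injective_iff_surjective.2 hsurj, hsurj⟩, ?_⟩
      exact Subtype.ext hr
  rw [tupleSum_eq, Finset.sum_congr rfl (g := fun _ => mobBot (Set.univ : Set (Submodule R N)) ⊤)
    fun x _ => by rw [muInv, hinv], Finset.sum_const, nsmul_eq_mul, Finset.card_univ,
    ← Nat.card_eq_fintype_card, ← Nat.card_congr CommTuple.single, Nat.card_eq_of_bijective _ hbij]

/-- `N` is a vector space over `R ⧸ m` with the same submodules and automorphisms, and not being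
cyclic means dimension at least 2. -/
theorem tupleSum_unit_of_isTorsionBySet {N : Type u} [AddCommGroup N] [Module R N] [Finite N]
    {m : Ideal R} [hm : m.IsMaximal] (h : Module.IsTorsionBySet R N m)
    (hN : ¬ ∃ v : N, Submodule.span R {v} = ⊤) : tupleSum Unit R N = 0 := by
  let _ : Field (R ⧸ m) := Ideal.Quotient.field m
  let _ : Module (R ⧸ m) N := h.module
  have : IsScalarTower R (R ⧸ m) N := h.isScalarTower
  have hsurj : Function.Surjective (algebraMap R (R ⧸ m)) := Ideal.Quotient.mk_surjective
  have hspan : ∀ v : N, Submodule.span (R ⧸ m) {v} = ⊤ → Submodule.span R {v} = ⊤ := by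
    intro v hv
    rw [Submodule.eq_top_iff'] at hv ⊢
    intro n
    obtain ⟨a, ha⟩ := Submodule.mem_span_singleton.1 (hv n)
    obtain ⟨r, rfl⟩ := hsurj a
    rw [algebraMap_smul] at ha
    exact Submodule.mem_span_singleton.2 ⟨r, ha⟩
  have hrank : 2 ≤ Module.finrank (R ⧸ m) N := by
    by_contra hlt
    have : Module.Finite (R ⧸ m) N := Module.Finite.of_finite
    obtain ⟨v, hv⟩ := finrank_le_one_iff.1 (show Module.finrank (R ⧸ m) N ≤ 1 by omega)
    refine hN ⟨v, hspan v ?_⟩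
    rw [Submodule.eq_top_iff']
    intro n
    exact Submodule.mem_span_singleton.2 (hv n)
  rw [← tupleSum_unit_eq_zero (R ⧸ m) _ N rfl hrank]
  have := Fintype.ofFinite (CommTuple Unit R N)
  have := Fintype.ofFinite (CommTuple Unit (R ⧸ m) N)
  rw [tupleSum_eq, tupleSum_eq]
  let e : (N ≃ₗ[R] N) ≃ (N ≃ₗ[R ⧸ m] N) :=
    { toFun := fun g => LinearEquiv.extendScalarsOfSurjective hsurj g
      invFun := fun g => g.restrictScalars R
      left_inv := fun _ => rfl
      right_inv := fun _ => rfl }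
  refine Fintype.sum_equiv (CommTuple.single.symm.trans (e.trans CommTuple.single)) _ _ fun x => ?_
  refine mobBot_top_eq_of_addEquiv (AddEquiv.refl N) (fun U hU => ?_) (fun U hU => ?_)
  · refine ⟨{ U with smul_mem' := fun a n hn => ?_ }, fun i u => hU i u, fun n => Iff.rfl⟩
    obtain ⟨r, rfl⟩ := hsurj a
    rw [algebraMap_smul]
    exact U.smul_mem r hn
  · exact ⟨U.restrictScalars R, fun i u => hU i u, fun n => Iff.rfl⟩

theorem exists_span_eq_top_of_isCompl_smul {N : Type*} [AddCommGroup N] [Module R N] [Finite N]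
    {m : Ideal R} {D : Submodule R N} (h : IsCompl (m • (⊤ : Submodule R N)) D)
    (hm : m • D = ⊥) {c : ↥(m • (⊤ : Submodule R N))} {d : D} (hc : Submodule.span R {c} = ⊤)
    (hd : Submodule.span R {d} = ⊤) : ∃ v : N, Submodule.span R {v} = ⊤ := by
  -- With `C = m N`, the decomposition and `m D = 0` give `C = m C`. Nakayama's lemma yields `r ≡ 1`
  -- modulo `m` with `r C = 0`; it fixes `D`, hence `r (c + d) = d` and `c + d` generates.
  obtain ⟨r, hr1, hr0⟩ := Submodule.exists_sub_one_mem_and_smul_eq_zero_of_fg_of_le_smul m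
    (m • (⊤ : Submodule R N)) (Submodule.FG.of_finite) (by
      conv_lhs => rw [← h.sup_eq_top, Submodule.smul_sup, hm, sup_bot_eq])
  have hrd : r • (d : N) = d := by
    have h1 : (r - 1) • (d : N) ∈ m • D := Submodule.smul_mem_smul hr1 d.2
    rw [hm, Submodule.mem_bot, sub_smul, one_smul, sub_eq_zero] at h1
    exact h1
  refine ⟨c + d, ?_⟩
  have hdm : (d : N) ∈ Submodule.span R {(c : N) + d} := by
    refine Submodule.mem_span_singleton.2 ⟨r, ?_⟩
    rw [smul_add, hr0 c c.2, hrd, zero_add]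
  have hcm : (c : N) ∈ Submodule.span R {(c : N) + d} := by
    have := Submodule.sub_mem _ (Submodule.mem_span_singleton_self ((c : N) + d)) hdm
    simpa using this
  rw [Submodule.eq_top_iff']
  intro n
  obtain ⟨a, b, rfl⟩ := exists_add_of_isCompl h n
  obtain ⟨s, hs⟩ := Submodule.mem_span_singleton.1 (hc ▸ trivial : a ∈ Submodule.span R {c})
  obtain ⟨t, ht⟩ := Submodule.mem_span_singleton.1 (hd ▸ trivial : b ∈ Submodule.span R {d})
  rw [← hs, ← ht]
  exact Submodule.add_mem _ (Submodule.smul_mem _ s hcm) (Submodule.smul_mem _ t hdm)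

-- Crapo's theorem at the characteristic submodule `m N` splits the sum into products over `m N` and
-- its complements `D`. These factors cannot both come from cyclic modules: `m N` is handled by
-- induction and `D`, being killed by `m`, by linear algebra.
open Classical in
theorem tupleSum_unit_of_not_cyclic (n : ℕ) :
    ∀ (N : Type u) [AddCommGroup N] [Module R N] [Finite N], Nat.card N = n →
      (¬ ∃ v : N, Submodule.span R {v} = ⊤) → tupleSum Unit R N = 0 := by
  induction n using Nat.strong_induction_on with
  | _ n ih =>
  intro N _ _ _ hn hN
  have hann : Module.annihilator R N ≠ ⊤ := by
    intro h
    rw [Module.annihilator_eq_top_iff] at h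
    exact hN ⟨0, Subsingleton.elim _ _⟩
  obtain ⟨m, hm, hle⟩ := Ideal.exists_le_maximal _ hann
  -- If `m N = N`, Nakayama's lemma gives an element of the annihilator, hence of `m`, that is
  -- congruent to 1 modulo `m`.
  have hC : m • (⊤ : Submodule R N) ≠ ⊤ := by
    intro h
    obtain ⟨r, hr1, hr0⟩ := Submodule.exists_sub_one_mem_and_smul_eq_zero_of_fg_of_le_smul m
      (⊤ : Submodule R N) (Submodule.FG.of_finite) h.ge
    have hr : r ∈ m := hle (Module.mem_annihilator.2 fun n => hr0 n trivial)
    exact hm.ne_top ((Ideal.eq_top_iff_one m).2 (by simpa using m.sub_mem hr hr1))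
  have hCinv : ∀ x : CommTuple Unit R N, m • (⊤ : Submodule R N) ∈ invSub x.1 := by
    intro x
    rw [mem_invSub_iff_map]
    intro i
    rw [Submodule.map_smul'', Submodule.map_top, LinearEquiv.range]
  have := Fintype.ofFinite (Submodule R N)
  have := Fintype.ofFinite (CommTuple Unit R N)
  have := Fintype.ofFinite (CommTuple Unit R ↥(m • (⊤ : Submodule R N)))
  rw [tupleSum_eq, Finset.sum_congr rfl fun x _ => x.muInv_eq_sum (hCinv x)]
  simp only [Finset.sum_filter]
  rw [Finset.sum_comm]
  refine Finset.sum_eq_zero fun D _ => ?_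
  by_cases hD : IsCompl (m • (⊤ : Submodule R N)) D
  swap
  · simp [hD]
  have := Fintype.ofFinite (CommTuple Unit R D)
  have hsplit := CommTuple.sum_split hD (fun y => muInv y.1) (fun z => muInv z.1)
    (fun x => muInv (x.restrict _ (hCinv x)).1 *
      (if hD : D ∈ invSub x.1 then muInv (x.restrict D hD).1 else 0))
    (fun x h1 h2 => by rw [dif_pos h2])
  simp only [hD, and_true, ← Finset.sum_filter]
  simp only [hCinv, true_and] at hsplit
  rw [hsplit, ← tupleSum_eq, ← tupleSum_eq]
  have hlt : Nat.card ↥(m • (⊤ : Submodule R N)) < n := by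
    obtain ⟨w, hw⟩ : ∃ w, w ∉ m • (⊤ : Submodule R N) := by
      by_contra! hall
      exact hC ((Submodule.eq_top_iff').2 hall)
    rw [← hn]
    exact Finite.card_subtype_lt hw
  by_cases hcyc : ∃ c : ↥(m • (⊤ : Submodule R N)), Submodule.span R {c} = ⊤
  swap
  · rw [ih _ hlt _ rfl hcyc, zero_mul]
  obtain ⟨c, hc⟩ := hcyc
  have hmD : m • D = ⊥ := by
    rw [← le_bot_iff, ← hD.inf_eq_bot]
    exact le_inf (Submodule.smul_mono le_rfl le_top) Submodule.smul_le_right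
  have hDcyc : ¬ ∃ d : D, Submodule.span R {d} = ⊤ := by
    rintro ⟨d, hd⟩
    exact hN (exists_span_eq_top_of_isCompl_smul hD hmD hc hd)
  rw [tupleSum_unit_of_isTorsionBySet (m := m) ?_ hDcyc, mul_zero]
  rintro d ⟨a, ha⟩
  apply Subtype.ext
  have : a • (d : N) ∈ m • D := Submodule.smul_mem_smul ha d.2
  rwa [hmD] at this

/-- Summing over one more commuting automorphism amounts to counting cyclic vectors. -/
theorem tupleSum_unit (N : Type u) [AddCommGroup N] [Module R N] [Finite N] :
    tupleSum Unit R N = Nat.card {w : N // Submodule.span R {w} = ⊤} *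
      mobBot (Set.univ : Set (Submodule R N)) ⊤ := by
  by_cases h : ∃ v : N, Submodule.span R {v} = ⊤
  · exact tupleSum_unit_of_span_eq_top h.choose_spec
  · have : IsEmpty {w : N // Submodule.span R {w} = ⊤} := ⟨fun w => h ⟨w.1, w.2⟩⟩
    rw [tupleSum_unit_of_not_cyclic _ N rfl h, Nat.card_of_isEmpty, Nat.cast_zero, zero_mul]

end Cyclic

/-! ### Cyclic vectors and one more commuting automorphism. -/

section CycSum

/-- The sum over commuting families of the Möbius number times the number of cyclic vectors. -/
noncomputable def cycSum (ι R N : Type*) [Ring R] [AddCommGroup N] [Module R N] [Finite ι]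
    [Finite N] : ℤ :=
  ∑ᶠ x : CommTuple ι R N, cycCard x.1 * muInv x.1

theorem cycSum_eq (ι R N : Type*) [Ring R] [AddCommGroup N] [Module R N] [Finite ι]
    [Finite N] [Fintype (CommTuple ι R N)] :
    cycSum ι R N = ∑ x : CommTuple ι R N, cycCard x.1 * muInv x.1 :=
  finsum_eq_sum_of_fintype _

variable {ι K V : Type*} [Field K] [AddCommGroup V] [Module K V] [Finite V]

/-- The case of `tupleSum_unit` where the ring acts on `V` through the algebra generated by a
commuting family. -/
theorem sum_centralizer_eq_cycCard_mul_of_ring {R : Type*} [CommRing R] [Module R V]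
    (x : ι → V ≃ₗ[K] V) [Fintype {g : V ≃ₗ[K] V // ∀ i, Commute g (x i)}]
    (hK : ∀ c : K, ∃ r : R, ∀ v : V, r • v = c • v) (hx : ∀ i, ∃ r : R, ∀ v : V, r • v = x i v)
    (hU : ∀ U : Submodule K V, (∀ i, ∀ u ∈ U, x i u ∈ U) → ∀ r : R, ∀ u ∈ U, r • u ∈ U)
    (hg : ∀ g : V ≃ₗ[K] V, (∀ i, Commute g (x i)) → ∀ (r : R) (v : V), g (r • v) = r • g v) :
    ∑ g : {g : V ≃ₗ[K] V // ∀ i, Commute g (x i)},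
      mobBot (invSub x ∩ invSub fun _ : Unit => g.1) ⊤ = cycCard x * muInv x := by
  have := Fintype.ofFinite (CommTuple Unit R V)
  let toK : Submodule R V → Submodule K V := fun U =>
    { U.toAddSubmonoid with
      smul_mem' := fun c u hu => by
        obtain ⟨r, hr⟩ := hK c
        rw [← hr]
        exact U.smul_mem r hu }
  let toR : ∀ U : Submodule K V, U ∈ invSub x → Submodule R V := fun U h =>
    { U.toAddSubmonoid with
      smul_mem' := fun r u hu => hU U (fun i u hu => (h i u).2 hu) r u hu }
  have htoK : ∀ U, toK U ∈ invSub x := fun U i => forall_mem_iff_of_forall_mem fun u hu => by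
    obtain ⟨r, hr⟩ := hx i
    rw [← hr]
    exact U.smul_mem r hu
  have hmu : mobBot (Set.univ : Set (Submodule R V)) ⊤ = muInv x :=
    mobBot_top_eq_of_addEquiv (AddEquiv.refl V) (fun U _ => ⟨toK U, htoK U, fun n => Iff.rfl⟩)
      (fun U h => ⟨toR U h, trivial, fun n => Iff.rfl⟩)
  have hcyc : Nat.card {w : V // Submodule.span R {w} = ⊤} = cycCard x := by
    refine Nat.card_congr (Equiv.subtypeEquivRight fun w => ⟨fun h U hUx hw => ?_, fun h => ?_⟩)
    · have h1 : Submodule.span R {w} ≤ toR U hUx := by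
        rw [Submodule.span_singleton_le_iff_mem]
        exact hw
      rw [h, top_le_iff] at h1
      rw [Submodule.eq_top_iff'] at h1 ⊢
      exact h1
    · have h1 := h (toK (Submodule.span R {w})) (htoK _) (Submodule.mem_span_singleton_self w)
      rw [Submodule.eq_top_iff'] at h1 ⊢
      exact h1
  have h := tupleSum_unit (R := R) V
  rw [hmu, hcyc, tupleSum_eq] at h
  rw [← h]
  let e : {g : V ≃ₗ[K] V // ∀ i, Commute g (x i)} ≃ CommTuple Unit R V :=
    { toFun := fun g => CommTuple.single
        { g.1.toAddEquiv with map_smul' := fun r v => hg g.1 g.2 r v }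
      invFun := fun y => ⟨{ (y.1 ()).toAddEquiv with
        map_smul' := fun c v => by
          obtain ⟨r, hr⟩ := hK c
          change y.1 () (c • v) = c • y.1 () v
          rw [← hr, ← hr, map_smul] }, fun i => by
          obtain ⟨r, hr⟩ := hx i
          ext v
          change y.1 () (x i v) = x i (y.1 () v)
          rw [← hr, ← hr, map_smul]⟩
      left_inv := fun _ => rfl
      right_inv := fun _ => rfl }
  refine Fintype.sum_equiv e _ _ fun g => ?_
  refine mobBot_top_eq_of_addEquiv (AddEquiv.refl V) (fun U h => ?_) (fun U h => ?_)
  · exact ⟨toR U h.1, fun i u => h.2 i u, fun n => Iff.rfl⟩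
  · exact ⟨toK U, ⟨htoK U, fun i u => h i u⟩, fun n => Iff.rfl⟩

-- The ring is the algebra generated by the family, commutative because the family commutes. Its
-- submodules are the invariant subspaces, its module automorphisms the centralizer, its generators
-- the cyclic vectors.
open scoped IsMulCommutative in
theorem sum_centralizer_eq_cycCard_mul (x : CommTuple ι K V)
    [Fintype {g : V ≃ₗ[K] V // ∀ i, Commute g (x.1 i)}] :
    ∑ g : {g : V ≃ₗ[K] V // ∀ i, Commute g (x.1 i)},
      mobBot (invSub x.1 ∩ invSub fun _ : Unit => g.1) ⊤ = cycCard x.1 * muInv x.1 := by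
  let s : Set (Module.End K V) := Set.range fun i => (x.1 i : V →ₗ[K] V)
  have : IsMulCommutative (Algebra.adjoin K s) := Algebra.isMulCommutative_adjoin K (by
    rintro _ ⟨i, rfl⟩ _ ⟨j, rfl⟩
    ext v
    exact LinearEquiv.congr_fun (x.2 i j) v)
  refine sum_centralizer_eq_cycCard_mul_of_ring (R := Algebra.adjoin K s) x.1 ?_ ?_ ?_ ?_
  · intro c
    exact ⟨algebraMap K _ c, fun v => rfl⟩
  · intro i
    exact ⟨⟨_, Algebra.subset_adjoin ⟨i, rfl⟩⟩, fun v => rfl⟩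
  · rintro U h ⟨f, hf⟩
    change ∀ u ∈ U, f u ∈ U
    induction hf using Algebra.adjoin_induction with
    | mem f hf =>
      obtain ⟨i, rfl⟩ := hf
      exact h i
    | algebraMap c => exact fun u hu => U.smul_mem c hu
    | add f g _ _ hf hg => exact fun u hu => U.add_mem (hf u hu) (hg u hu)
    | mul f g _ _ hf hg => exact fun u hu => hf _ (hg u hu)
  · rintro g h ⟨f, hf⟩
    change ∀ v, g (f v) = f (g v)
    induction hf using Algebra.adjoin_induction with
    | mem f hf =>
      obtain ⟨i, rfl⟩ := hf
      exact fun v => LinearEquiv.congr_fun (h i) v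
    | algebraMap c => exact fun v => map_smul g c v
    | add f₁ f₂ _ _ h₁ h₂ =>
      intro v
      rw [LinearMap.add_apply, LinearMap.add_apply, map_add, h₁, h₂]
    | mul f₁ f₂ _ _ h₁ h₂ =>
      intro v
      rw [Module.End.mul_apply, Module.End.mul_apply, h₁, h₂]

/-- A commuting family of `r + 1` automorphisms is one of `r` automorphisms together with an
automorphism that commutes with all of them. -/
def CommTuple.consEquiv (r : ℕ) :
    CommTuple (Fin (r + 1)) K V ≃
      Σ x : CommTuple (Fin r) K V, {g : V ≃ₗ[K] V // ∀ i, Commute g (x.1 i)} where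
  toFun y := ⟨⟨fun i => y.1 i.succ, fun i j => y.2 _ _⟩, y.1 0, fun i => y.2 _ _⟩
  invFun p := ⟨Fin.cons p.2.1 p.1.1, fun i j => by
    refine Fin.cases ?_ (fun i => ?_) i <;> refine Fin.cases ?_ (fun j => ?_) j
    · exact Commute.refl _
    · exact p.2.2 j
    · exact (p.2.2 i).symm
    · exact p.1.2 i j⟩
  left_inv y := by
    refine Subtype.ext (funext fun i => ?_)
    refine Fin.cases ?_ (fun i => ?_) i <;> rfl
  right_inv p := rfl

theorem tupleSum_succ (r : ℕ) : tupleSum (Fin (r + 1)) K V = cycSum (Fin r) K V := by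
  classical
  have := Fintype.ofFinite (CommTuple (Fin r) K V)
  have := Fintype.ofFinite (CommTuple (Fin (r + 1)) K V)
  have := fun x : CommTuple (Fin r) K V =>
    Fintype.ofFinite {g : V ≃ₗ[K] V // ∀ i, Commute g (x.1 i)}
  rw [cycSum_eq, tupleSum_eq, Finset.sum_congr rfl fun x _ =>
    (sum_centralizer_eq_cycCard_mul x).symm, ← Fintype.sum_sigma']
  refine Fintype.sum_equiv (CommTuple.consEquiv r) _ _ fun y => ?_
  refine mobBot_congr fun U _ => ⟨fun h => ⟨fun i => h i.succ, fun _ => h 0⟩, fun h i => ?_⟩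
  refine Fin.cases ?_ (fun i => ?_) i
  · exact h.2 ()
  · exact h.1 i

end CycSum

/-! ### Expansion over direct sum decompositions. -/

section Convolution

variable {ι R N : Type*} [Ring R] [AddCommGroup N] [Module R N]

open Classical in
/-- Every vector is a cyclic vector of exactly one invariant submodule. -/
theorem CommTuple.sum_cycCard_restrict [Finite N] [Fintype (Submodule R N)]
    (x : CommTuple ι R N) :
    ∑ C : Submodule R N, (if hC : C ∈ invSub x.1 then cycCard (x.restrict C hC).1 else 0) =
      Nat.card N := by
  have := Fintype.ofFinite N
  -- `cl v` is the invariant submodule generated by `v`; the cyclic vectors of `C` are exactly the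
  -- fibre of `cl` over `C`.
  let cl : N → Submodule R N := fun v => sInf {U | U ∈ invSub x.1 ∧ v ∈ U}
  have hcl : ∀ v, cl v ∈ invSub x.1 := by
    intro v i u
    simp only [cl, Submodule.mem_sInf]
    exact forall_congr' fun U => forall_congr' fun hU => hU.1 i u
  have hv : ∀ v, v ∈ cl v := fun v => by
    simp only [cl, Submodule.mem_sInf]
    exact fun U hU => hU.2
  rw [Nat.card_eq_fintype_card, ← Finset.card_univ,
    Finset.card_eq_sum_card_fiberwise (f := cl) (t := Finset.univ) (by simp)]
  refine Finset.sum_congr rfl fun C _ => ?_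
  by_cases hC : C ∈ invSub x.1
  swap
  · rw [dif_neg hC, eq_comm, Finset.card_eq_zero, Finset.filter_eq_empty_iff]
    rintro v - rfl
    exact hC (hcl v)
  rw [dif_pos hC, cycCard, ← Fintype.card_subtype, ← Nat.card_eq_fintype_card]
  have hiff : ∀ v : C, (∀ U ∈ invSub (x.restrict C hC).1, v ∈ U → U = ⊤) ↔ cl v = C := by
    intro v
    constructor
    · intro h
      apply le_antisymm
      · exact sInf_le ⟨hC, v.2⟩
      · have := h ((cl v).comap C.subtype) (fun i u => hcl v i u) (hv v)
        rwa [Submodule.comap_subtype_eq_top] at this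
    · intro h U hU hvU
      have hmem : U.map C.subtype ∈ invSub x.1 := by
        rw [mem_invSub_iff_map] at hU ⊢
        intro i
        conv_rhs => rw [← hU i]
        rw [← Submodule.map_comp, ← Submodule.map_comp]
        rfl
      have h1 : cl v ≤ U.map C.subtype := sInf_le ⟨hmem, ⟨v, hvU, rfl⟩⟩
      rw [h] at h1
      rw [Submodule.eq_top_iff']
      intro u
      obtain ⟨w, hw, hwu⟩ := h1 u.2
      rwa [← Subtype.ext hwu]
  refine Nat.card_congr
    { toFun := fun v => ⟨v.1, (hiff v.1).1 v.2⟩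
      invFun := fun v => ⟨⟨v.1, v.2.le (hv v.1)⟩, (hiff _).2 v.2⟩
      left_inv := fun _ => rfl
      right_inv := fun _ => rfl }

-- For each family, `|N|` is expanded as the sum of `cycCard` over invariant `C`, and Crapo's
-- theorem is applied at that same `C`. Exchanging the sums fixes the decomposition and lets the
-- families on its summands vary independently.
open Classical in
theorem card_mul_tupleSum [Finite ι] [Finite N] [Fintype (Submodule R N)] :
    Nat.card N * tupleSum ι R N =
      ∑ p : Submodule R N × Submodule R N with IsCompl p.1 p.2,
        cycSum ι R p.1 * tupleSum ι R p.2 := by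
  have := Fintype.ofFinite (CommTuple ι R N)
  have hx : ∀ x : CommTuple ι R N, (Nat.card N : ℤ) * muInv x.1 =
      ∑ p : Submodule R N × Submodule R N with IsCompl p.1 p.2,
        if h : p.1 ∈ invSub x.1 ∧ p.2 ∈ invSub x.1 then
          cycCard (x.restrict p.1 h.1).1 * muInv (x.restrict p.1 h.1).1 *
            muInv (x.restrict p.2 h.2).1 else 0 := by
    intro x
    rw [← x.sum_cycCard_restrict, Nat.cast_sum, Finset.sum_mul, Finset.sum_filter,
      Fintype.sum_prod_type]
    refine Finset.sum_congr rfl fun C _ => ?_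
    by_cases hC : C ∈ invSub x.1
    swap
    · simp [hC]
    rw [dif_pos hC, x.muInv_eq_sum hC, Finset.mul_sum, Finset.sum_filter]
    refine Finset.sum_congr rfl fun D _ => ?_
    by_cases hD : D ∈ invSub x.1
    · simp only [hC, hD, true_and, and_self, dif_pos, mul_assoc]
    · simp [hD]
  rw [tupleSum_eq, Finset.mul_sum, Finset.sum_congr rfl fun x _ => hx x, Finset.sum_comm]
  refine Finset.sum_congr rfl fun p hp => ?_
  have := Fintype.ofFinite (CommTuple ι R p.1)
  have := Fintype.ofFinite (CommTuple ι R p.2)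
  rw [cycSum_eq, tupleSum_eq, ← CommTuple.sum_split (Finset.mem_filter.1 hp).2
    (fun y => cycCard y.1 * muInv y.1) (fun z => muInv z.1)
    (fun x => if h : p.1 ∈ invSub x.1 ∧ p.2 ∈ invSub x.1 then
          cycCard (x.restrict p.1 h.1).1 * muInv (x.restrict p.1 h.1).1 *
            muInv (x.restrict p.2 h.2).1 else 0) (fun x h1 h2 => dif_pos ⟨h1, h2⟩),
    Finset.sum_filter]
  refine Finset.sum_congr rfl fun x _ => ?_
  by_cases h : p.1 ∈ invSub x.1 ∧ p.2 ∈ invSub x.1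
  · rw [if_pos h]
  · rw [dif_neg h, if_neg h]

end Convolution

/-! ### Invariance under isomorphism. -/

section Transport

variable {ι R N N' : Type*} [Ring R] [AddCommGroup N] [Module R N] [AddCommGroup N'] [Module R N']

/-- Conjugation of commuting families by an isomorphism. -/
def CommTuple.congr (e : N ≃ₗ[R] N') : CommTuple ι R N ≃ CommTuple ι R N' where
  toFun x := ⟨fun i => e.symm ≪≫ₗ x.1 i ≪≫ₗ e, fun i j => LinearEquiv.ext fun v => by
    have := LinearEquiv.congr_fun (x.2 i j) (e.symm v)
    simpa using this⟩
  invFun x := ⟨fun i => e ≪≫ₗ x.1 i ≪≫ₗ e.symm, fun i j => LinearEquiv.ext fun v => by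
    have := LinearEquiv.congr_fun (x.2 i j) (e v)
    simpa using this⟩
  left_inv x := Subtype.ext (funext fun i => LinearEquiv.ext fun v => by simp)
  right_inv x := Subtype.ext (funext fun i => LinearEquiv.ext fun v => by simp)

theorem exists_mem_invSub_congr (e : N ≃ₗ[R] N') (x : CommTuple ι R N) :
    (∀ U ∈ invSub x.1, ∃ U' ∈ invSub (CommTuple.congr e x).1, ∀ n, e n ∈ U' ↔ n ∈ U) ∧
    (∀ U' ∈ invSub (CommTuple.congr e x).1, ∃ U ∈ invSub x.1, ∀ n, e n ∈ U' ↔ n ∈ U) := by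
  constructor
  · intro U hU
    refine ⟨U.comap (e.symm : N' →ₗ[R] N), fun i u => ?_, fun n => by simp⟩
    have h : e.symm ((CommTuple.congr e x).1 i u) = x.1 i (e.symm u) := e.symm_apply_apply _
    rw [Submodule.mem_comap, Submodule.mem_comap, LinearEquiv.coe_coe, h, hU]
  · intro U' hU'
    refine ⟨U'.comap (e : N →ₗ[R] N'), fun i u => ?_, fun n => Iff.rfl⟩
    have h : (CommTuple.congr e x).1 i (e u) = e (x.1 i u) :=
      congrArg (fun v => e (x.1 i v)) (e.symm_apply_apply u)
    rw [Submodule.mem_comap, Submodule.mem_comap, LinearEquiv.coe_coe, ← h, hU' i]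

theorem tupleSum_congr [Finite ι] [Finite N] [Finite N'] (e : N ≃ₗ[R] N') :
    tupleSum ι R N = tupleSum ι R N' :=
  finsum_eq_of_bijective _ (CommTuple.congr e).bijective fun x =>
    mobBot_top_eq_of_addEquiv e.toAddEquiv (exists_mem_invSub_congr e x).1
      (exists_mem_invSub_congr e x).2

theorem cycSum_congr [Finite ι] [Finite N] [Finite N'] (e : N ≃ₗ[R] N') :
    cycSum ι R N = cycSum ι R N' :=
  finsum_eq_of_bijective _ (CommTuple.congr e).bijective fun x => by
    rw [muInv, mobBot_top_eq_of_addEquiv e.toAddEquiv (exists_mem_invSub_congr e x).1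
      (exists_mem_invSub_congr e x).2, cycCard_eq_of_addEquiv e.toAddEquiv
      (exists_mem_invSub_congr e x).1 (exists_mem_invSub_congr e x).2]
    rfl

end Transport

/-! ### Direct sum decompositions as isomorphisms from a product. -/

section Counting

variable {K V : Type*} [Field K] [AddCommGroup V] [Module K V]

/-- A direct sum decomposition of `V` with bases of both summands is an isomorphism onto `V`. -/
theorem bijective_prodCongr_trans_prodEquivOfIsCompl (A B : Type*) [AddCommGroup A] [Module K A]
    [AddCommGroup B] [Module K B] :
    Function.Bijective (fun s : (Σ p : {p : Submodule K V × Submodule K V // IsCompl p.1 p.2},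
      (A ≃ₗ[K] p.1.1) × (B ≃ₗ[K] p.1.2)) =>
      (s.2.1.prodCongr s.2.2) ≪≫ₗ Submodule.prodEquivOfIsCompl s.1.1.1 s.1.1.2 s.1.2) := by
  have happ : ∀ (p : {p : Submodule K V × Submodule K V // IsCompl p.1 p.2}) (α : A ≃ₗ[K] p.1.1)
      (β : B ≃ₗ[K] p.1.2) (a : A) (b : B),
      ((α.prodCongr β) ≪≫ₗ Submodule.prodEquivOfIsCompl p.1.1 p.1.2 p.2) (a, b) = α a + β b := by
    intro p α β a b
    rw [LinearEquiv.trans_apply, Submodule.coe_prodEquivOfIsCompl']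
    rfl
  constructor
  · rintro ⟨⟨⟨C, D⟩, h⟩, α, β⟩ ⟨⟨⟨C', D'⟩, h'⟩, α', β'⟩ heq
    dsimp only at heq
    have h1 : ∀ a, (α a : V) = α' a := fun a => by
      have := LinearEquiv.congr_fun heq (a, 0)
      rw [happ ⟨(C, D), h⟩, happ ⟨(C', D'), h'⟩] at this
      simpa using this
    have h2 : ∀ b, (β b : V) = β' b := fun b => by
      have := LinearEquiv.congr_fun heq (0, b)
      rw [happ ⟨(C, D), h⟩, happ ⟨(C', D'), h'⟩] at this
      simpa using this
    obtain rfl : C = C' := by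
      ext v
      constructor
      · intro hv
        have := h1 (α.symm ⟨v, hv⟩)
        rw [α.apply_symm_apply] at this
        exact (show v = _ from this) ▸ (α' _).2
      · intro hv
        have := h1 (α'.symm ⟨v, hv⟩)
        rw [α'.apply_symm_apply] at this
        exact (show _ = v from this) ▸ (α _).2
    obtain rfl : D = D' := by
      ext v
      constructor
      · intro hv
        have := h2 (β.symm ⟨v, hv⟩)
        rw [β.apply_symm_apply] at this
        exact (show v = _ from this) ▸ (β' _).2
      · intro hv
        have := h2 (β'.symm ⟨v, hv⟩)
        rw [β'.apply_symm_apply] at this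
        exact (show _ = v from this) ▸ (β _).2
    obtain rfl : α = α' := LinearEquiv.ext fun a => Subtype.ext (h1 a)
    obtain rfl : β = β' := LinearEquiv.ext fun b => Subtype.ext (h2 b)
    rfl
  · intro φ
    let f : A →ₗ[K] V := (φ : A × B →ₗ[K] V) ∘ₗ LinearMap.inl K A B
    let g : B →ₗ[K] V := (φ : A × B →ₗ[K] V) ∘ₗ LinearMap.inr K A B
    have hf : Function.Injective f := φ.injective.comp LinearMap.inl_injective
    have hg : Function.Injective g := φ.injective.comp LinearMap.inr_injective
    have hcompl : IsCompl (LinearMap.range f) (LinearMap.range g) := by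
      rw [LinearMap.range_comp, LinearMap.range_comp]
      exact (Submodule.orderIsoMapComap φ).isCompl LinearMap.isCompl_range_inl_inr
    refine ⟨⟨⟨(LinearMap.range f, LinearMap.range g), hcompl⟩,
      LinearEquiv.ofInjective f hf, LinearEquiv.ofInjective g hg⟩, ?_⟩
    refine LinearEquiv.ext fun ab => ?_
    obtain ⟨a, b⟩ := ab
    dsimp only
    rw [happ ⟨(LinearMap.range f, LinearMap.range g), hcompl⟩]
    change φ (a, 0) + φ (0, b) = φ (a, b)
    rw [← map_add]
    simp

end Counting

/-! ### The recurrence for the normalized sums and its initial values. -/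

section Recurrence

variable {K : Type*} [Field K]

theorem card_linearEquiv_eq {A M : Type*} [AddCommGroup A] [Module K A] [Finite A]
    [AddCommGroup M] [Module K M] [Finite M] :
    Nat.card (A ≃ₗ[K] M) =
      if Module.finrank K M = Module.finrank K A then Nat.card (A ≃ₗ[K] A) else 0 := by
  have : Module.Finite K A := Module.Finite.of_finite
  have : Module.Finite K M := Module.Finite.of_finite
  split_ifs with h
  · let e : M ≃ₗ[K] A := LinearEquiv.ofFinrankEq _ _ h
    exact Nat.card_congr
      { toFun := fun g => g ≪≫ₗ e
        invFun := fun g => g ≪≫ₗ e.symm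
        left_inv := fun g => by ext; simp
        right_inv := fun g => by ext; simp }
  · have : IsEmpty (A ≃ₗ[K] M) := ⟨fun g => h g.finrank_eq.symm⟩
    exact Nat.card_of_isEmpty

open Classical in
/-- The number of decompositions of `V` into complementary subspaces of given dimensions. -/
theorem card_isCompl_mul {V : Type*} [AddCommGroup V] [Module K V] [Finite V]
    [Fintype (Submodule K V)] (A B : Type*) [AddCommGroup A] [Module K A] [Finite A]
    [AddCommGroup B] [Module K B] [Finite B]
    (h : Module.finrank K A + Module.finrank K B = Module.finrank K V) :
    (Finset.univ.filter fun p : Submodule K V × Submodule K V =>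
      IsCompl p.1 p.2 ∧ Module.finrank K p.1 = Module.finrank K A).card *
        (Nat.card (A ≃ₗ[K] A) * Nat.card (B ≃ₗ[K] B)) = Nat.card (V ≃ₗ[K] V) := by
  have : Module.Finite K A := Module.Finite.of_finite
  have : Module.Finite K B := Module.Finite.of_finite
  have : Module.Finite K V := Module.Finite.of_finite
  have h1 : Nat.card ((A × B) ≃ₗ[K] V) = Nat.card (V ≃ₗ[K] V) := by
    let e : (A × B) ≃ₗ[K] V := LinearEquiv.ofFinrankEq _ _ (by rw [Module.finrank_prod, h])
    exact Nat.card_congr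
      { toFun := fun g => e.symm ≪≫ₗ g
        invFun := fun g => e ≪≫ₗ g
        left_inv := fun g => by ext; simp
        right_inv := fun g => by ext; simp }
  -- Isomorphisms `A × B → V` are counted by the images of the two factors; only decompositions with
  -- the right dimensions contribute.
  rw [← h1, ← Nat.card_eq_of_bijective _ (bijective_prodCongr_trans_prodEquivOfIsCompl A B),
    Nat.card_sigma]
  rw [Finset.sum_congr rfl fun p _ => by
    rw [Nat.card_prod, card_linearEquiv_eq (A := A), card_linearEquiv_eq (A := B)],
    ← Finset.sum_subtype (p := fun p : Submodule K V × Submodule K V => IsCompl p.1 p.2)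
    (Finset.univ.filter fun p => IsCompl p.1 p.2) (by simp)
    (fun p => (if Module.finrank K p.1 = Module.finrank K A then Nat.card (A ≃ₗ[K] A) else 0) *
      (if Module.finrank K p.2 = Module.finrank K B then Nat.card (B ≃ₗ[K] B) else 0)),
    ← Finset.filter_filter, ← smul_eq_mul, ← Finset.sum_const, Finset.sum_filter]
  refine Finset.sum_congr rfl fun p hp => ?_
  have hp' := Submodule.finrank_add_eq_of_isCompl (Finset.mem_filter.1 hp).2
  by_cases hA : Module.finrank K p.1 = Module.finrank K A
  · rw [if_pos hA, if_pos hA, if_pos (by omega)]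
  · rw [if_neg hA, if_neg hA, zero_mul]

variable (K) [Finite K]

/-- `tupleSum` for `K ^ n`, divided by the order of the general linear group. -/
noncomputable def normSum (r n : ℕ) : ℚ :=
  tupleSum (Fin r) K (Fin n → K) / Nat.card ((Fin n → K) ≃ₗ[K] (Fin n → K))

/-- A term of the convolution depends only on the dimensions `(a, b)` of the summands, and `|GL_n| /
(|GL_a| |GL_b|)` decompositions share them; dividing by `|GL_n|` normalizes both factors. -/
theorem normSum_recurrence (r n : ℕ) :
    (Nat.card K : ℚ) ^ n * normSum K r n =
      ∑ ab ∈ Finset.HasAntidiagonal.antidiagonal n, normSum K (r + 1) ab.1 * normSum K r ab.2 := by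
  classical
  have := Fintype.ofFinite (Submodule K (Fin n → K))
  have hpos : ∀ m : ℕ, (Nat.card ((Fin m → K) ≃ₗ[K] (Fin m → K)) : ℚ) ≠ 0 := fun m =>
    Nat.cast_ne_zero.2 Nat.card_pos.ne'
  have hconv := card_mul_tupleSum (ι := Fin r) (R := K) (N := Fin n → K)
  have hterm : ∀ p ∈ (Finset.univ.filter fun p : Submodule K (Fin n → K) × Submodule K (Fin n → K)
      => IsCompl p.1 p.2), cycSum (Fin r) K p.1 * tupleSum (Fin r) K p.2 =
      ∑ ab ∈ Finset.HasAntidiagonal.antidiagonal n, if Module.finrank K p.1 = ab.1 then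
        tupleSum (Fin (r + 1)) K (Fin ab.1 → K) * tupleSum (Fin r) K (Fin ab.2 → K) else 0 := by
    intro p hp
    have hp' := Submodule.finrank_add_eq_of_isCompl (Finset.mem_filter.1 hp).2
    rw [Module.finrank_fin_fun] at hp'
    rw [Finset.sum_eq_single (Module.finrank K p.1, Module.finrank K p.2), if_pos rfl,
      tupleSum_succ, cycSum_congr (LinearEquiv.ofFinrankEq p.1 (Fin (Module.finrank K p.1) → K)
        (by simp)), tupleSum_congr (LinearEquiv.ofFinrankEq p.2 (Fin (Module.finrank K p.2) → K)
        (by simp))]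
    · rintro ⟨a, b⟩ hab hne
      refine if_neg fun h => hne ?_
      have := Finset.HasAntidiagonal.mem_antidiagonal.1 hab
      dsimp only at h this
      refine Prod.ext h.symm ?_
      dsimp only
      omega
    · intro h
      exact absurd (Finset.HasAntidiagonal.mem_antidiagonal.2 hp') h
  rw [Finset.sum_congr rfl hterm, Finset.sum_comm, Nat.card_fun, Nat.card_fin] at hconv
  have hconv' := congrArg (Int.cast : ℤ → ℚ) hconv
  rw [normSum, ← mul_div_assoc, div_eq_iff (hpos n), Finset.sum_mul]
  push_cast at hconv'
  rw [hconv']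
  refine Finset.sum_congr rfl fun ab hab => ?_
  have hcount := card_isCompl_mul (K := K) (V := Fin n → K) (Fin ab.1 → K) (Fin ab.2 → K)
    (by simpa using Finset.HasAntidiagonal.mem_antidiagonal.1 hab)
  rw [← Finset.sum_filter, Finset.filter_filter, Finset.sum_const, nsmul_eq_mul, normSum, normSum,
    ← hcount]
  rw [Module.finrank_fin_fun]
  have h1 := hpos ab.1
  have h2 := hpos ab.2
  push_cast
  field_simp

/-- The zero space has Möbius number 1, whereas its empty poset of proper subspaces has reduced
Euler characteristic `-1`; the constant term 1 of the series is thus the one that fits the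
recurrence. -/
theorem normSum_zero (r : ℕ) : normSum K r 0 = 1 := by
  have := Fintype.ofFinite (CommTuple (Fin r) K (Fin 0 → K))
  have hsub : Subsingleton ((Fin 0 → K) ≃ₗ[K] (Fin 0 → K)) :=
    ⟨fun f g => LinearEquiv.ext fun v => Subsingleton.elim _ _⟩
  have hmu : ∀ x : CommTuple (Fin r) K (Fin 0 → K), muInv x.1 = 1 := fun x => by
    rw [muInv, Subsingleton.elim (⊤ : Submodule K (Fin 0 → K)) ⊥, mobBot_bot]
  have hu : Unique (CommTuple (Fin r) K (Fin 0 → K)) :=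
    { default := ⟨fun _ => 1, fun _ _ => Commute.refl _⟩
      uniq := fun x => Subsingleton.elim _ _ }
  rw [normSum, tupleSum_eq, Finset.sum_congr rfl fun x _ => hmu x, Finset.sum_const,
    Finset.card_univ, ← Nat.card_eq_fintype_card, Nat.card_unique,
    Nat.card_eq_one_iff_unique.2 ⟨hsub, ⟨1⟩⟩]
  simp

theorem normSum_one (n : ℕ) :
    normSum K 1 n = if n = 0 then 1 else if n = 1 then -1 else 0 := by
  by_cases h0 : n = 0
  · rw [if_pos h0, h0, normSum_zero]
  rw [if_neg h0]
  have := Fintype.ofFinite (CommTuple Unit K (Fin n → K))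
  have hunit : tupleSum (Fin 1) K (Fin n → K) = tupleSum Unit K (Fin n → K) := by
    refine finsum_eq_of_bijective (fun x => ⟨fun _ => x.1 0, fun _ _ => Commute.refl _⟩)
      ⟨fun x y h => Subtype.ext (funext fun i => ?_), fun y => ⟨⟨fun _ => y.1 (), fun _ _ =>
        Commute.refl _⟩, rfl⟩⟩ fun x => ?_
    · rw [Subsingleton.elim i 0]
      exact congrFun (congrArg Subtype.val h) ()
    · refine mobBot_congr fun U _ => ⟨fun h _ => h 0, fun h i => ?_⟩
      rw [Subsingleton.elim i 0]
      exact h ()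
  by_cases h1 : n = 1
  · rw [if_pos h1]
    subst h1
    have hmu : ∀ x : CommTuple Unit K (Fin 1 → K), muInv x.1 = -1 := fun x =>
      mobBot_of_finrank_eq_one (by simp)
    rw [normSum, hunit, tupleSum_eq, Finset.sum_congr rfl fun x _ => hmu x, Finset.sum_const,
      Finset.card_univ, ← Nat.card_eq_fintype_card, ← Nat.card_congr CommTuple.single]
    have : (Nat.card ((Fin 1 → K) ≃ₗ[K] (Fin 1 → K)) : ℚ) ≠ 0 := Nat.cast_ne_zero.2 Nat.card_pos.ne'
    simp only [nsmul_eq_mul, mul_neg, mul_one, Int.cast_neg, Int.cast_natCast]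
    rw [neg_div, div_self this]
  · rw [if_neg h1, normSum, hunit, tupleSum_unit_eq_zero K n (Fin n → K) (by simp) (by omega)]
    simp

end Recurrence

/-! ### Equivariant Euler characteristics as normalized sums. -/

section EquivariantEulerChar

variable (K : Type u) [Field K]

/-- The images of the standard generators under a homomorphism from `ℤ ^ r`. -/
def homToTuple {V : Type*} [AddCommGroup V] [Module K V] (r : ℕ)
    (X : Multiplicative (Fin r → ℤ) →* LinearMap.GeneralLinearGroup K V) :
    CommTuple (Fin r) K V :=
  ⟨fun i => LinearMap.GeneralLinearGroup.generalLinearEquiv K V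
    (X (Multiplicative.ofAdd (Pi.single i 1))), fun _ _ =>
    ((Commute.all _ _).map X).map (LinearMap.GeneralLinearGroup.generalLinearEquiv K V)⟩

theorem hom_zpow_forall_mem {G : Type*} [Group G] {r : ℕ} (X : Multiplicative (Fin r → ℤ) →* G)
    (H : Subgroup G) (h : ∀ i, X (Multiplicative.ofAdd (Pi.single i 1)) ∈ H)
    (v : Multiplicative (Fin r → ℤ)) : X v ∈ H := by
  have hv : Multiplicative.toAdd v ∈ Subgroup.toAddSubgroup' (H.comap X) := by
    rw [pi_eq_sum_univ' (Multiplicative.toAdd v)]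
    exact sum_mem fun i _ => zsmul_mem
      (show Pi.single i (1 : ℤ) ∈ Subgroup.toAddSubgroup' (H.comap X) from h i) _
  exact hv

/-- `ℤ ^ r` is the free abelian group on its standard generators. -/
theorem homToTuple_bijective {V : Type*} [AddCommGroup V] [Module K V] (r : ℕ) :
    Function.Bijective (homToTuple K (V := V) r) := by
  constructor
  · intro X Y h
    have hgen : ∀ i, X (Multiplicative.ofAdd (Pi.single i 1)) =
        Y (Multiplicative.ofAdd (Pi.single i 1)) := fun i =>
      (LinearMap.GeneralLinearGroup.generalLinearEquiv K V).injective
        (congrFun (congrArg Subtype.val h) i)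
    refine MonoidHom.ext fun v => ?_
    have hv : Multiplicative.toAdd v ∈ Subgroup.toAddSubgroup' (MonoidHom.eqLocus X Y) := by
      rw [pi_eq_sum_univ' (Multiplicative.toAdd v)]
      exact sum_mem fun i _ => zsmul_mem
        (show Pi.single i (1 : ℤ) ∈ Subgroup.toAddSubgroup' (MonoidHom.eqLocus X Y) from hgen i) _
    exact hv
  · intro x
    let e := LinearMap.GeneralLinearGroup.generalLinearEquiv K V
    have hcomm : Pairwise fun i j => ∀ a b : Multiplicative ℤ,
        Commute (zpowersHom _ (e.symm (x.1 i)) a) (zpowersHom _ (e.symm (x.1 j)) b) := by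
      intro i j _ a b
      simp only [zpowersHom_apply]
      exact (((x.2 i j).map e.symm).zpow_zpow _ _)
    refine ⟨(MonoidHom.noncommPiCoprod (fun i => zpowersHom _ (e.symm (x.1 i))) hcomm).comp
      (MulEquiv.piMultiplicative fun _ : Fin r => ℤ).toMonoidHom, ?_⟩
    refine Subtype.ext (funext fun i => ?_)
    have hs : MulEquiv.piMultiplicative (fun _ : Fin r => ℤ)
        (Multiplicative.ofAdd (Pi.single i 1)) = Pi.mulSingle i (Multiplicative.ofAdd (1 : ℤ)) := by
      funext j
      by_cases hj : j = i
      · subst hj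
        simp
      · simp [hj]
    change e (MonoidHom.noncommPiCoprod _ hcomm (MulEquiv.piMultiplicative (fun _ : Fin r => ℤ)
        (Multiplicative.ofAdd (Pi.single i 1)))) = x.1 i
    rw [hs, MonoidHom.noncommPiCoprod_mulSingle]
    simp

/-- A subspace is fixed by the image of `X` once it is fixed by the images of the generators. For
nonzero `V` the Möbius number is by definition the chain sum of the open interval. -/
theorem redEulerChar_fixedPoints {V : Type*} [AddCommGroup V] [Module K V] [Finite V]
    [Nontrivial V] (r : ℕ) (X : Multiplicative (Fin r → ℤ) →* LinearMap.GeneralLinearGroup K V) :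
    redEulerChar (MulAction.fixedPoints X.range (ProperSubspace K V)) =
      muInv (homToTuple K r X).1 := by
  let φ : MulAction.fixedPoints X.range (ProperSubspace K V) ↪o Submodule K V :=
    (OrderEmbedding.subtype _).trans (OrderEmbedding.subtype _)
  rw [redEulerChar_eq_chainSum, ← chainSum_image φ, muInv, mobBot, if_neg top_ne_bot]
  congr 1
  rw [Set.image_univ]
  ext U
  constructor
  · rintro ⟨⟨⟨U, hU⟩, hfix⟩, rfl⟩
    refine ⟨?_, bot_lt_iff_ne_bot.2 hU.1, lt_top_iff_ne_top.2 hU.2⟩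
    rw [mem_invSub_iff_map]
    intro i
    exact congrArg Subtype.val (hfix ⟨X (Multiplicative.ofAdd (Pi.single i 1)), ⟨_, rfl⟩⟩)
  · rintro ⟨hU, hb, ht⟩
    rw [mem_invSub_iff_map] at hU
    refine ⟨⟨⟨U, hb.ne', ht.ne⟩, ?_⟩, rfl⟩
    rintro ⟨_, v, rfl⟩
    exact hom_zpow_forall_mem X (MulAction.stabilizer _ (⟨U, hb.ne', ht.ne⟩ : ProperSubspace K V))
      (fun i => Subtype.ext (hU i)) v

variable [Finite K]

theorem chiGL_eq_normSum (r n : ℕ) (hn : n ≠ 0) : chiGL K r n = normSum K r n := by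
  have : NeZero n := ⟨hn⟩
  rw [chiGL, eqRedEulerChar, normSum, tupleSum, one_div_mul_eq_div]
  congr 1
  · rw [finsum_eq_of_bijective (g := fun x : CommTuple (Fin r) K (Fin n → K) => (muInv x.1 : ℚ)) _
      (homToTuple_bijective K r) fun X => by rw [redEulerChar_fixedPoints]]
    exact ((Int.castAddHom ℚ).map_finsum (Set.toFinite _)).symm
  · rw [Nat.card_congr (LinearMap.GeneralLinearGroup.generalLinearEquiv K (Fin n → K)).toEquiv]

theorem coeff_genFun (r n : ℕ) : PowerSeries.coeff n (genFun K r) = normSum K r n := by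
  rw [genFun, PowerSeries.coeff_mk]
  split_ifs with h
  · rw [h, normSum_zero]
  · exact chiGL_eq_normSum K r n h

theorem genFun_one : genFun K 1 = 1 - PowerSeries.X := by
  ext n
  rw [coeff_genFun, normSum_one, map_sub, PowerSeries.coeff_one, PowerSeries.coeff_X]
  split_ifs <;> simp_all

theorem genFun_succ_mul (r : ℕ) :
    genFun K (r + 1) * genFun K r = PowerSeries.rescale (Nat.card K : ℚ) (genFun K r) := by
  ext n
  rw [PowerSeries.coeff_mul, PowerSeries.coeff_rescale, coeff_genFun, normSum_recurrence]
  simp only [coeff_genFun]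

theorem constantCoeff_genFun (r : ℕ) : PowerSeries.constantCoeff (genFun K r) = 1 := by
  rw [← PowerSeries.coeff_zero_eq_constantCoeff_apply, coeff_genFun, normSum_zero]

end EquivariantEulerChar

/-! ### The series with `q` as a variable. -/

section Generic

/-- Evaluation of the variable `q` at a natural number, coefficientwise. -/
noncomputable abbrev evalSeries (q : ℕ) : PowerSeries (Polynomial ℤ) →+* PowerSeries ℚ :=
  PowerSeries.map (Polynomial.eval₂RingHom (Int.castRingHom ℚ) (q : ℚ))

/-- A series over `ℤ[q]` is determined by its values at the orders of finite fields. -/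
theorem eq_of_evalSeries_eq {F G : PowerSeries (Polynomial ℤ)}
    (h : ∀ (K : Type u) [Field K] [Finite K],
      evalSeries (Nat.card K) F = evalSeries (Nat.card K) G) :
    F = G := by
  ext1 n
  apply Polynomial.map_injective (Int.castRingHom ℚ) Int.cast_injective
  refine Polynomial.eq_of_infinite_eval_eq _ _ (Set.Infinite.mono ?_
    (Nat.infinite_setOfPred_prime.image (Nat.cast_injective (R := ℚ)).injOn))
  rintro _ ⟨p, hp, rfl⟩
  have : Fact p.Prime := ⟨hp⟩
  -- Prime fields already give infinitely many evaluation points; `ULift` places them in the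
  -- required universe.
  have hp' := congrArg (PowerSeries.coeff n) (h (ULift.{u} (ZMod p)))
  have hcard : Nat.card (ULift.{u} (ZMod p)) = p := by
    rw [Nat.card_congr Equiv.ulift, Nat.card_zmod]
  rw [hcard, PowerSeries.coeff_map, PowerSeries.coeff_map] at hp'
  simpa [Polynomial.eval_map] using hp'

theorem evalSeries_rescale (q : ℕ) (F : PowerSeries (Polynomial ℤ)) :
    evalSeries q (PowerSeries.rescale Polynomial.X F) =
      PowerSeries.rescale (q : ℚ) (evalSeries q F) := by
  ext n
  simp [PowerSeries.coeff_rescale]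

/-- A series with constant term 1 is invertible over `ℤ[q]`, so `F_r(qx) / F_r(x)` has coefficients
in `ℤ[q]`; the constant term is carried through the induction for this purpose. -/
theorem exists_isGenericGenFun (r : ℕ) :
    ∃ F : PowerSeries (Polynomial ℤ), PowerSeries.constantCoeff F = 1 ∧
      IsGenericGenFun.{u} (r + 1) F := by
  induction r with
  | zero =>
    refine ⟨1 - PowerSeries.X, by simp, fun K _ _ => ?_⟩
    rw [genFun_one]
    simp
  | succ r ih =>
    obtain ⟨F, hF1, hF⟩ := ih
    have hinv : PowerSeries.invOfUnit F 1 * F = 1 := by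
      rw [mul_comm]
      exact PowerSeries.mul_invOfUnit F 1 (by simpa using hF1)
    refine ⟨PowerSeries.rescale Polynomial.X F * PowerSeries.invOfUnit F 1, ?_, fun K _ _ => ?_⟩
    · rw [map_mul, PowerSeries.constantCoeff_invOfUnit,
        ← PowerSeries.coeff_zero_eq_constantCoeff_apply, PowerSeries.coeff_rescale]
      simp [hF1]
    -- Over the domain `ℚ⟦x⟧` the functional equation determines the next series, since the nonzero
    -- factor `genFun K (r + 1)` can be cancelled.
    · have hne : genFun K (r + 1) ≠ 0 := by
        intro h
        have := constantCoeff_genFun K (r + 1)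
        simp [h] at this
      apply mul_right_cancel₀ hne
      rw [genFun_succ_mul, ← hF K, ← map_mul, mul_assoc, hinv, mul_one]
      exact evalSeries_rescale _ _

end Generic

/-- The identities hold for the generating functions at each prime power `q = |K|`. Moreover the
`r`th generating functions at all `q` come from one series in `ℤ[q]⟦x⟧`, and the identities hold
in `ℤ[q]⟦x⟧`. -/
theorem theorem1p2 :
    (∀ (K : Type u) [Field K] [Finite K],
      genFun K 1 = 1 - PowerSeries.X ∧
      ∀ r : ℕ, 1 ≤ r →
        genFun K (r + 1) * genFun K r = PowerSeries.rescale (Nat.card K : ℚ) (genFun K r)) ∧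
    (∀ r : ℕ, 1 ≤ r → ∃! F : PowerSeries (Polynomial ℤ), IsGenericGenFun.{u} r F) ∧
    (∀ F : PowerSeries (Polynomial ℤ), IsGenericGenFun.{u} 1 F → F = 1 - PowerSeries.X) ∧
    (∀ r : ℕ, 1 ≤ r → ∀ F F' : PowerSeries (Polynomial ℤ),
      IsGenericGenFun.{u} r F → IsGenericGenFun.{u} (r + 1) F' →
        F' * F = PowerSeries.rescale (Polynomial.X : Polynomial ℤ) F) := by
  refine ⟨fun K _ _ => ⟨genFun_one K, fun r _ => genFun_succ_mul K r⟩, fun r hr => ?_,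
    fun F hF => ?_, fun r _ F F' hF hF' => ?_⟩
  · obtain ⟨s, rfl⟩ := Nat.exists_eq_add_of_le' hr
    obtain ⟨F, -, hF⟩ := exists_isGenericGenFun.{u} s
    exact ⟨F, hF, fun G hG => eq_of_evalSeries_eq.{u} fun K _ _ => (hG K).trans (hF K).symm⟩
  · refine eq_of_evalSeries_eq.{u} fun K _ _ => ?_
    rw [hF K, genFun_one]
    simp
  · refine eq_of_evalSeries_eq.{u} fun K _ _ => ?_
    rw [evalSeries_rescale, map_mul, hF K, hF' K, genFun_succ_mul]
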